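/- Let $0<\delta<1/4$ and let $\Phi$ be the standard normal c.d.f. Let $\mathcal F$ be the set of continuously differentiable, strictly increasing $f:(0,1)\to\mathbb R$ with $f(1/2)=0$ and $f(3/4)-f(1/4)=1$, and let $d(f,g)=\sup_{\delta\le x\le 1-\delta}|f(x)-g(x)|$. Truth: let $\mu_0\in\mathbb R$, $\sigma_0>0$, $f_0\in\mathcal F$ with $f_0'>0$ on $[\delta,1-\delta]$, and let $X_1,X_2,\dots$ be i.i.d. in $(0,1)$ with $f_0(X_i)\sim N(\mu_0,\sigma_0^2)$. Among $X_1,\dots,X_n$ let $X_1^*,\dots,X_{n^*}^*$ be those in $[\delta,1-\delta]$, and let $n_-^*$, $n_+^*$ be the numbers of those below $\delta$ and above $1-\delta$, respectively. Model: for $\mu\in\mathbb R$, $\sigma>0$, $f\in\mathcal F$ put $F_{\mu,\sigma,f}(x)=\Phi((f(x)-\mu)/\sigma)$ and, for $x\in[\delta,1-\delta]$, $$F^*_{\mu,\sigma,f}(x)=\frac{F_{\mu,\sigma,f}(x)-F_{\mu,\sigma,f}(\delta)}{F_{\mu,\sigma,f}(1-\delta)-F_{\mu,\sigma,f}(\delta)},$$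 with density $p^*_{\mu,\sigma,f}$ on $[\delta,1-\delta]$. Let $F_0=F_{\mu_0,\sigma_0,f_0}$, $\pi_0^-=F_0(\delta)$, $\pi_0^+=1-F_0(1-\delta)$. Priors: let $(\mu,\sigma)$ and $f$ be independent under the prior, where the law of $(\mu,\sigma)$ is a probability measure on $\mathbb R\times(0,\infty)$ and the law $\Pi$ of $f$ is a probability measure on $\mathcal F$. Let $\Lambda$ be a prior probability measure for $(\pi^-,\pi^+)$ on $\{(a,b):a,b>0,\ a+b<1\}$. Modified posterior: draw $(\mu,\sigma,f)$ from its posterior given $X_1^*,\dots,X_{n^*}^*$ (likelihood $\prod_i p^*_{\mu,\sigma,f}(X_i^*)$), which gives $F^*=F^*_{\mu,\sigma,f}$; independently draw $(\pi^-,\pi^+)$ from its posterior given the counts (likelihood $(\pi^-)^{n_-^*}(\pi^+)^{n_+^*}(1-\pi^--\pi^+)^{n^*}$); set $F=\pi^-+(1-\pi^+-\pi^-)F^*$ on $[\delta,1-\delta]$. The modified posterior of $(\mu,\sigma,f)$, with $f$ considered on $[\delta,1-\delta]$, is the law of $$\sigma=\frac{1}{\Phi^{-1}(F(3/4))-\Phi^{-1}(F(1/4))},\qquad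 \mu=-\frac{\Phi^{-1}(F(1/2))}{\Phi^{-1}(F(3/4))-\Phi^{-1}(F(1/4))},\qquad f(x)=\mu+\sigma\,\Phi^{-1}(F(x)).$$ Theorem. Assume that $(\mu_0,\sigma_0)$ is in the support of the prior of $(\mu,\sigma)$, that $\Pi(f: d(f,f_0)<\epsilon,\ d(f',f_0')<\epsilon)>0$ for every $\epsilon>0$, and that the posterior of $(\pi^-,\pi^+)$ given the counts is consistent, i.e. for every $\epsilon>0$ its mass on $\{|\pi^--\pi_0^-|<\epsilon,\ |\pi^+-\pi_0^+|<\epsilon\}$ tends to $1$ almost surely as $n\to\infty$. Then for every $\epsilon>0$ the modified posterior probability of $$\{|\mu-\mu_0|<\epsilon,\ |\sigma-\sigma_0|<\epsilon,\ d(f,f_0)<\epsilon\}$$ given $X_1^*,\dots,X_{n^*}^*,n_-^*,n_+^*$ tends to $1$ almost surely as $n\to\infty$. -/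

import Mathlib

open MeasureTheory ProbabilityTheory Filter Topology Set
open scoped ENNReal NNReal

noncomputable section

namespace Nonparanormal

/-- The standard normal c.d.f. `Φ`. -/
def stdNormalCDF (x : ℝ) : ℝ := cdf (gaussianReal 0 1) x

/-- The standard normal quantile function `Φ⁻¹` (meaningful for `0 < p < 1`). -/
def stdNormalQuantile (p : ℝ) : ℝ := sInf {x : ℝ | p ≤ stdNormalCDF x}

/-- Continuously differentiable, strictly increasing transformations of `(0,1)`, normalized by
`f (1/2) = 0` and `f (3/4) - f (1/4) = 1`. Values outside `(0,1)` are never used. -/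
structure IsTransformation (f : ℝ → ℝ) : Prop where
  contDiffOn : ContDiffOn ℝ 1 f (Ioo 0 1)
  strictMonoOn : StrictMonoOn f (Ioo 0 1)
  median : f (1 / 2) = 0
  quartiles : f (3 / 4) - f (1 / 4) = 1

/-- The space of transformations, with the σ-algebra generated by the evaluations. -/
abbrev Transformation : Type := {f : ℝ → ℝ // IsTransformation f}

/-- The parameter `((μ, σ), f)`. -/
abbrev Param : Type := (ℝ × ℝ) × Transformation

/-- The c.d.f. of `X` when `f X ∼ N(μ, σ²)`, for `x` in `(0,1)`. -/
def modelCDF (θ : Param) (x : ℝ) : ℝ := stdNormalCDF ((θ.2.1 x - θ.1.1) / θ.1.2)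

/-- The density of `X` when `f X ∼ N(μ, σ²)`, for `x` in `(0,1)`. -/
def modelPDF (θ : Param) (x : ℝ) : ℝ :=
  gaussianPDFReal 0 1 ((θ.2.1 x - θ.1.1) / θ.1.2) / θ.1.2 * deriv θ.2.1 x

/-- The c.d.f. `F*` of an observation conditioned to lie in `[δ, 1 - δ]`, for `x` in that
interval. -/
def truncCDF (δ : ℝ) (θ : Param) (x : ℝ) : ℝ :=
  (modelCDF θ x - modelCDF θ δ) / (modelCDF θ (1 - δ) - modelCDF θ δ)

/-- The density of `F*` on `[δ, 1 - δ]`. -/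
def truncPDF (δ : ℝ) (θ : Param) (x : ℝ) : ℝ :=
  modelPDF θ x / (modelCDF θ (1 - δ) - modelCDF θ δ)

/-- Indices, among the first `n` observations, of those falling in `[δ, 1 - δ]`. -/
def complying (δ : ℝ) (x : ℕ → ℝ) (n : ℕ) : Finset ℕ := by
  classical exact (Finset.range n).filter (fun i => δ ≤ x i ∧ x i ≤ 1 - δ)

/-- The number of observations below `δ` among the first `n`. -/
def countBelow (δ : ℝ) (x : ℕ → ℝ) (n : ℕ) : ℕ := by
  classical exact ((Finset.range n).filter (fun i => x i < δ)).card

/-- The number of observations above `1 - δ` among the first `n`. -/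
def countAbove (δ : ℝ) (x : ℕ → ℝ) (n : ℕ) : ℕ := by
  classical exact ((Finset.range n).filter (fun i => 1 - δ < x i)).card

/-- The likelihood of the observations in `[δ, 1 - δ]` under the truncated model. -/
def truncLikelihood (δ : ℝ) (x : ℕ → ℝ) (n : ℕ) (θ : Param) : ℝ≥0∞ :=
  ENNReal.ofReal (∏ i ∈ complying δ x n, truncPDF δ θ (x i))

/-- The trinomial likelihood of `q = (π⁻, π⁺)` given the counts below `δ` and above `1 - δ`
(up to the multinomial coefficient, which does not depend on `q`). -/
def splitLikelihood (δ : ℝ) (x : ℕ → ℝ) (n : ℕ) (q : ℝ × ℝ) : ℝ≥0∞ :=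
  ENNReal.ofReal (q.1 ^ countBelow δ x n * q.2 ^ countAbove δ x n *
    (1 - q.1 - q.2) ^ (n - countBelow δ x n - countAbove δ x n))

/-- Bayes' formula: `A ↦ ∫_A L d(prior) / ∫ L d(prior)`. -/
def bayesPosterior {T : Type*} [MeasurableSpace T] (prior : Measure T) (L : T → ℝ≥0∞) :
    Measure T :=
  (∫⁻ t, L t ∂prior)⁻¹ • prior.withDensity L

/-- The posterior of `((μ, σ), f)` given the observations falling in `[δ, 1 - δ]`, where `(μ, σ)`
and `f` are a priori independent with laws `ρ` and `Π`. -/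
def truncPosterior (ρ : Measure (ℝ × ℝ)) (Pf : Measure Transformation) (δ : ℝ) (x : ℕ → ℝ)
    (n : ℕ) : Measure Param :=
  bayesPosterior (ρ.prod Pf) (truncLikelihood δ x n)

/-- The posterior of `(π⁻, π⁺)` given the counts below `δ` and above `1 - δ`, from a prior `Λ`. -/
def splitPosterior (Λ : Measure (ℝ × ℝ)) (δ : ℝ) (x : ℕ → ℝ) (n : ℕ) : Measure (ℝ × ℝ) :=
  bayesPosterior Λ (splitLikelihood δ x n)

/-- The function `F = π⁻ + (1 - π⁺ - π⁻) F*` on `[δ, 1 - δ]`, with `F*` the truncated c.d.f. at the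
parameter `z.1` and `(π⁻, π⁺) = z.2`. -/
def inducedCDF (δ : ℝ) (z : Param × (ℝ × ℝ)) (x : ℝ) : ℝ :=
  z.2.1 + (1 - z.2.2 - z.2.1) * truncCDF δ z.1 x

/-- `σ = 1 / (Φ⁻¹(F(3/4)) - Φ⁻¹(F(1/4)))`. -/
def scaleOf (F : ℝ → ℝ) : ℝ :=
  1 / (stdNormalQuantile (F (3 / 4)) - stdNormalQuantile (F (1 / 4)))

/-- `μ = - Φ⁻¹(F(1/2)) / (Φ⁻¹(F(3/4)) - Φ⁻¹(F(1/4)))`. -/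
def locationOf (F : ℝ → ℝ) : ℝ :=
  -stdNormalQuantile (F (1 / 2)) /
    (stdNormalQuantile (F (3 / 4)) - stdNormalQuantile (F (1 / 4)))

/-- `f(x) = μ + σ Φ⁻¹(F(x))`. -/
def transformationOf (F : ℝ → ℝ) (x : ℝ) : ℝ :=
  locationOf F + scaleOf F * stdNormalQuantile (F x)

/-- The modified posterior probability of an event `A` about `(μ, σ, f)`: the image, under
`F ↦ (μ, σ, f)`, of the law of `F = π⁻ + (1 - π⁺ - π⁻) F*`, where `F*` and `(π⁻, π⁺)` are drawn
from their respective posteriors. -/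
def modifiedPosterior (ρ : Measure (ℝ × ℝ)) (Pf : Measure Transformation) (Λ : Measure (ℝ × ℝ))
    (δ : ℝ) (x : ℕ → ℝ) (n : ℕ) (A : Set (ℝ × ℝ × (ℝ → ℝ))) : ℝ≥0∞ :=
  ((truncPosterior ρ Pf δ x n).prod (splitPosterior Λ δ x n))
    {z | (locationOf (inducedCDF δ z), scaleOf (inducedCDF δ z),
      transformationOf (inducedCDF δ z)) ∈ A}

/-- The uniform pseudo-distance `d(f, g) = sup {|f x - g x| : δ ≤ x ≤ 1 - δ}`, in `[0, ∞]`. -/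
def supDist (δ : ℝ) (f g : ℝ → ℝ) : ℝ≥0∞ :=
  ⨆ x ∈ Icc δ (1 - δ), ENNReal.ofReal |f x - g x|

end Nonparanormal

end

/-! The observations in `[δ, 1 - δ]` inform only about `F*`, and many `(μ, σ, f)` share the same
`F*`. Consistency is therefore proved for `F*` alone. The missing masses of the two tails come from
the posterior of `(π⁻, π⁺)`, and `F ↦ (μ, σ, f)` is continuous at the true c.d.f.

Consistency for `F*` is an argument of Schwartz type. The ratio `truncRatio` is `p*_θ / p*_θ₀` on
`[δ, 1 - δ]` and `1` elsewhere, so the likelihood ratio is a product over all `n` observations, and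
the random number `n*` never has to be conditioned on. The normalizing integral is at least `m * exp
(-c n)`, for any `c > 0` (`exists_mul_pow_le_lintegral_truncRatio`): near the truth in the `C¹`
sense, `p*_θ ≥ exp (-c) * p*_θ₀` uniformly on the interval, whatever the data. Conversely, if `F*_θ`
is off by `η` at `t`, then `θ` gives too much mass to `[δ, t]` or to `[t, 1 - δ]`. An exponential
tilt by the empirical frequency of that interval, harmless under the truth by the strong law, makes
the expected product exponentially small (`ae_tendsto_exp_mul_lintegral_prod`).

Finitely many `t` suffice, because monotone functions close to a continuous one on a fine grid are
uniformly close to it (`exists_finset_monotoneOn_close`). -/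

namespace Nonparanormal

/-! ### Exponential bounds for integrated likelihood ratios, and Bayes' formula -/

section Abstract

variable {Ω T E : Type*} [MeasurableSpace Ω] [MeasurableSpace T] [MeasurableSpace E]

/-- Tonelli moves the expectation inside; independence then factorizes it for each fixed `θ`. -/
theorem lintegral_lintegral_prod_le {P : Measure Ω} {X : ℕ → Ω → E}
    (hXm : ∀ i, Measurable (X i)) (hXi : iIndepFun X P) {Q : Measure E}
    (hXQ : ∀ i, P.map (X i) = Q) (ν : Measure T) [IsFiniteMeasure ν]
    {s : T → E → ℝ≥0∞} (hs : Measurable (Function.uncurry s)) {κ : ℝ≥0∞}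
    (hκ : ∀ᵐ θ ∂ν, ∫⁻ x, s θ x ∂Q ≤ κ) (n : ℕ) :
    ∫⁻ ω, ∫⁻ θ, ∏ i ∈ Finset.range n, s θ (X i ω) ∂ν ∂P ≤ κ ^ n * ν univ := by
  have : IsProbabilityMeasure P := hXi.isProbabilityMeasure
  have hm : Measurable (Function.uncurry fun (ω : Ω) (θ : T) =>
      ∏ i ∈ Finset.range n, s θ (X i ω)) := by
    refine Finset.measurable_fun_prod _ fun i _ => ?_
    exact hs.comp (measurable_snd.prodMk ((hXm i).comp measurable_fst))
  rw [lintegral_lintegral_swap hm.aemeasurable]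
  calc ∫⁻ θ, ∫⁻ ω, ∏ i ∈ Finset.range n, s θ (X i ω) ∂P ∂ν
      ≤ ∫⁻ _, κ ^ n ∂ν := by
        refine lintegral_mono_ae ?_
        filter_upwards [hκ] with θ hθ
        have hsθ : Measurable (s θ) := hs.comp measurable_prodMk_left
        rw [lintegral_prod_eq_prod_lintegral_of_indepFun (Finset.range n)
          (fun i ω => s θ (X i ω)) (hXi.comp (fun _ => s θ) fun _ => hsθ)
          fun i => hsθ.comp (hXm i)]
        calc ∏ i ∈ Finset.range n, ∫⁻ ω, s θ (X i ω) ∂P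
            = ∏ i ∈ Finset.range n, ∫⁻ x, s θ x ∂Q := by
              refine Finset.prod_congr rfl fun i _ => ?_
              rw [← hXQ i, lintegral_map hsθ (hXm i)]
          _ ≤ κ ^ n := by
              rw [Finset.prod_const, Finset.card_range]
              gcongr
    _ = κ ^ n * ν univ := lintegral_const _

/-- The expectations are dominated by a geometric series of ratio `C * κ`, so the random series
converges almost surely and its terms vanish. -/
theorem ae_tendsto_pow_mul_lintegral_prod {P : Measure Ω} {X : ℕ → Ω → E}
    (hXm : ∀ i, Measurable (X i)) (hXi : iIndepFun X P) {Q : Measure E}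
    (hXQ : ∀ i, P.map (X i) = Q) (ν : Measure T) [IsFiniteMeasure ν]
    {s : T → E → ℝ≥0∞} (hs : Measurable (Function.uncurry s)) {κ C : ℝ≥0∞}
    (hκ : ∀ᵐ θ ∂ν, ∫⁻ x, s θ x ∂Q ≤ κ) (hC : C * κ < 1) :
    ∀ᵐ ω ∂P, Tendsto (fun n : ℕ => C ^ n * ∫⁻ θ, ∏ i ∈ Finset.range n, s θ (X i ω) ∂ν)
      atTop (𝓝 0) := by
  have hm : ∀ n : ℕ, Measurable fun ω => ∫⁻ θ, ∏ i ∈ Finset.range n, s θ (X i ω) ∂ν := by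
    intro n
    have : Measurable fun p : Ω × T => ∏ i ∈ Finset.range n, s p.2 (X i p.1) := by
      refine Finset.measurable_fun_prod _ fun i _ => ?_
      exact hs.comp (measurable_snd.prodMk ((hXm i).comp measurable_fst))
    exact this.lintegral_prod_right'
  have hfin : ∫⁻ ω, ∑' n : ℕ, C ^ n * ∫⁻ θ, ∏ i ∈ Finset.range n, s θ (X i ω) ∂ν ∂P ≠ ∞ := by
    rw [lintegral_tsum fun n => ((hm n).const_mul _).aemeasurable]
    have hle : ∑' n : ℕ, ∫⁻ ω, C ^ n * ∫⁻ θ, ∏ i ∈ Finset.range n, s θ (X i ω) ∂ν ∂P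
        ≤ ∑' n : ℕ, (C * κ) ^ n * ν univ := by
      refine ENNReal.tsum_le_tsum fun n => ?_
      rw [lintegral_const_mul _ (hm n), mul_pow, mul_assoc]
      gcongr
      exact lintegral_lintegral_prod_le hXm hXi hXQ ν hs hκ n
    refine (hle.trans_lt ?_).ne
    rw [ENNReal.tsum_mul_right, ENNReal.tsum_geometric]
    refine ENNReal.mul_lt_top (ENNReal.inv_lt_top.2 (tsub_pos_of_lt hC)) (measure_lt_top _ _)
  filter_upwards [ae_lt_top' (Measurable.aemeasurable
    (Measurable.tsum fun n => (hm n).const_mul _)) hfin] with ω hω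
  exact ENNReal.tendsto_atTop_zero_of_tsum_ne_top hω.ne

/-- Guarantees that the normalizing integral in Bayes' formula is finite, simultaneously for all
`n`. -/
theorem ae_lintegral_prod_lt_top {P : Measure Ω} {X : ℕ → Ω → E}
    (hXm : ∀ i, Measurable (X i)) (hXi : iIndepFun X P) {Q : Measure E}
    (hXQ : ∀ i, P.map (X i) = Q) (ν : Measure T) [IsFiniteMeasure ν]
    {s : T → E → ℝ≥0∞} (hs : Measurable (Function.uncurry s))
    (hκ : ∀ᵐ θ ∂ν, ∫⁻ x, s θ x ∂Q ≤ 1) :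
    ∀ᵐ ω ∂P, ∀ n : ℕ, ∫⁻ θ, ∏ i ∈ Finset.range n, s θ (X i ω) ∂ν < ∞ := by
  rw [ae_all_iff]
  intro n
  have hm : Measurable fun p : Ω × T => ∏ i ∈ Finset.range n, s p.2 (X i p.1) := by
    refine Finset.measurable_fun_prod _ fun i _ => ?_
    exact hs.comp (measurable_snd.prodMk ((hXm i).comp measurable_fst))
  refine ae_lt_top' hm.lintegral_prod_right'.aemeasurable ?_
  refine ((lintegral_lintegral_prod_le hXm hXi hXQ ν hs hκ n).trans_lt ?_).ne
  simp

/-- Almost sure convergence of empirical frequencies. -/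
theorem ae_tendsto_frequency {P : Measure Ω} {X : ℕ → Ω → E}
    (hXm : ∀ i, Measurable (X i)) (hXi : iIndepFun X P) {Q : Measure E}
    (hXQ : ∀ i, P.map (X i) = Q) {G : Set E} (hG : MeasurableSet G) :
    ∀ᵐ ω ∂P, Tendsto (fun n : ℕ => (∑ i ∈ Finset.range n, G.indicator (fun _ => (1 : ℝ)) (X i ω))
      / n) atTop (𝓝 (Q.real G)) := by
  have : IsProbabilityMeasure P := hXi.isProbabilityMeasure
  have hg : Measurable (G.indicator fun _ => (1 : ℝ)) := measurable_const.indicator hG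
  have h := strong_law_ae_real (μ := P) (fun i => G.indicator (fun _ => (1 : ℝ)) ∘ X i)
    ?_ (fun i j hij => (hXi.comp (fun _ => G.indicator fun _ => (1 : ℝ)) fun _ => hg).indepFun hij)
    (fun i => IdentDistrib.comp ⟨(hXm i).aemeasurable, (hXm 0).aemeasurable,
      by rw [hXQ, hXQ]⟩ hg)
  · have hE : P[G.indicator (fun _ => (1 : ℝ)) ∘ X 0] = Q.real G := by
      have : G.indicator (fun _ => (1 : ℝ)) ∘ X 0 = (X 0 ⁻¹' G).indicator 1 := by
        rfl
      rw [this, integral_indicator_one (hXm 0 hG), ← hXQ 0, measureReal_def, measureReal_def,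
        Measure.map_apply (hXm 0) hG]
    rw [hE] at h
    exact h
  · have : G.indicator (fun _ => (1 : ℝ)) ∘ X 0 = (X 0 ⁻¹' G).indicator fun _ => 1 := by
      rfl
    rw [this]
    exact (integrable_const _).indicator (hXm 0 hG)

/-- Here `p` and `q` are the masses of a set under the truth and under an alternative. The tilt is
centred at `p + a`, halfway to the least possible `q = p + 2 * a`; the left side is the expectation
of the tilt `exp (a * (p + a - 1_G))` under the alternative. -/
theorem chernoff_exponent_le {p q a : ℝ} (ha : 0 ≤ a) (hq0 : 0 ≤ q) (hq1 : q ≤ 1) (hpq : p + 2 * a ≤ q) :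
    Real.exp (a * (p + a)) * (1 - q * (1 - Real.exp (-a))) ≤ Real.exp (-(a ^ 2 / 2)) := by
  have h1 : Real.exp (-a) ≤ 1 - a + a ^ 2 / 2 := by
    have h := Real.quadratic_le_exp_of_nonneg ha
    have h0 : 0 < 1 + a + a ^ 2 / 2 := by positivity
    rw [Real.exp_neg]
    refine (inv_anti₀ h0 h).trans ?_
    rw [inv_le_iff_one_le_mul₀ h0]
    -- `(1 - a + a ^ 2 / 2) * (1 + a + a ^ 2 / 2) = 1 + a ^ 4 / 4`.
    nlinarith [sq_nonneg (a ^ 2)]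
  have h2 : 1 - q * (1 - Real.exp (-a)) ≤ Real.exp (-(q * (a - a ^ 2 / 2))) := by
    refine le_trans ?_ (Real.add_one_le_exp _)
    nlinarith
  calc _ ≤ Real.exp (a * (p + a)) * Real.exp (-(q * (a - a ^ 2 / 2))) := by gcongr
    _ ≤ _ := by
      rw [← Real.exp_add]
      gcongr
      nlinarith [mul_nonneg ha (sub_nonneg.2 hpq), mul_nonneg (sq_nonneg a) (sub_nonneg.2 hq1)]

/-- Likelihood ratios putting excess mass on a set `G` have exponentially small integrals. -/
theorem ae_tendsto_exp_mul_lintegral_prod {P : Measure Ω} {X : ℕ → Ω → E}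
    (hXm : ∀ i, Measurable (X i)) (hXi : iIndepFun X P) {Q : Measure E}
    (hXQ : ∀ i, P.map (X i) = Q) (ν : Measure T) [IsFiniteMeasure ν]
    {r : T → E → ℝ≥0∞} (hr : Measurable (Function.uncurry r))
    {G : Set E} (hG : MeasurableSet G) {a : ℝ} (ha : 0 < a)
    (hr1 : ∀ᵐ θ ∂ν, ∫⁻ x, r θ x ∂Q = 1)
    (hrG : ∀ᵐ θ ∂ν, Q.real G + 2 * a ≤ (∫⁻ x in G, r θ x ∂Q).toReal) :
    ∀ᵐ ω ∂P, Tendsto (fun n : ℕ => ENNReal.ofReal (Real.exp (a ^ 2 / 4)) ^ n *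
      ∫⁻ θ, ∏ i ∈ Finset.range n, r θ (X i ω) ∂ν) atTop (𝓝 0) := by
  classical
  have : IsProbabilityMeasure P := hXi.isProbabilityMeasure
  set p := Q.real G with hp
  -- Summed over the sample, `w` is `a` times `n * (p + a)` minus the number of visits to `G`, hence
  -- eventually nonnegative by the law of large numbers: the tilted product `s` then dominates the
  -- product of the `r`.
  set w : E → ℝ := fun x => a * (p + a - G.indicator (fun _ => (1 : ℝ)) x) with hw
  have hwm : Measurable w := by
    have : Measurable (G.indicator fun _ => (1 : ℝ)) := measurable_const.indicator hG
    fun_prop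
  set s : T → E → ℝ≥0∞ := fun θ x => ENNReal.ofReal (Real.exp (w x)) * r θ x with hs
  have hsm : Measurable (Function.uncurry s) := by
    refine Measurable.mul ?_ hr
    exact (ENNReal.measurable_ofReal.comp (Real.measurable_exp.comp hwm)).comp measurable_snd
  have hκ : ∀ᵐ θ ∂ν, ∫⁻ x, s θ x ∂Q ≤ ENNReal.ofReal (Real.exp (-(a ^ 2 / 2))) := by
    filter_upwards [hr1, hrG] with θ h1 h2
    have hrθ : Measurable (r θ) := hr.comp measurable_prodMk_left
    have hadd := lintegral_add_compl (μ := Q) (r θ) hG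
    rw [h1] at hadd
    have hG1 : ∫⁻ x in G, r θ x ∂Q ≠ ∞ := ne_top_of_le_ne_top ENNReal.one_ne_top
      (hadd ▸ le_self_add)
    have hG2 : ∫⁻ x in Gᶜ, r θ x ∂Q ≠ ∞ := ne_top_of_le_ne_top ENNReal.one_ne_top
      (hadd ▸ le_add_self)
    set q := (∫⁻ x in G, r θ x ∂Q).toReal with hq
    have hq' : (∫⁻ x in Gᶜ, r θ x ∂Q).toReal = 1 - q := by
      have := congrArg ENNReal.toReal hadd
      rw [ENNReal.toReal_add hG1 hG2] at this
      simp at this; linarith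
    have hq0 : 0 ≤ q := ENNReal.toReal_nonneg
    have hq1 : 0 ≤ 1 - q := hq' ▸ ENNReal.toReal_nonneg
    have hin : ∫⁻ x in G, s θ x ∂Q = ENNReal.ofReal (Real.exp (a * (p + a - 1)) * q) := by
      rw [setLIntegral_congr_fun (g := fun x => ENNReal.ofReal (Real.exp (a * (p + a - 1))) * r θ x)
        hG (fun x hx => by simp [hs, hw, hx]), lintegral_const_mul _ hrθ,
        ENNReal.ofReal_mul (Real.exp_nonneg _), hq, ENNReal.ofReal_toReal hG1]
    have hout : ∫⁻ x in Gᶜ, s θ x ∂Q = ENNReal.ofReal (Real.exp (a * (p + a)) * (1 - q)) := by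
      rw [setLIntegral_congr_fun (g := fun x => ENNReal.ofReal (Real.exp (a * (p + a))) * r θ x)
        hG.compl (fun x hx => by
          have : x ∉ G := hx
          simp [hs, hw, this]), lintegral_const_mul _ hrθ,
        ENNReal.ofReal_mul (Real.exp_nonneg _), ← hq', ENNReal.ofReal_toReal hG2]
    rw [← lintegral_add_compl (μ := Q) (s θ) hG, hin, hout, ← ENNReal.ofReal_add
      (by positivity) (by positivity)]
    refine ENNReal.ofReal_le_ofReal ?_
    refine le_trans (le_of_eq ?_) (chernoff_exponent_le (p := p) ha.le hq0 (by linarith) h2)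
    rw [show a * (p + a - 1) = a * (p + a) + -a by ring, Real.exp_add]
    ring
  -- Half of the decay rate `a ^ 2 / 2` is kept for the conclusion; the other half makes the series
  -- converge.
  have hC : ENNReal.ofReal (Real.exp (a ^ 2 / 4)) * ENNReal.ofReal (Real.exp (-(a ^ 2 / 2))) < 1 := by
    rw [← ENNReal.ofReal_mul (Real.exp_nonneg _), ← Real.exp_add, ENNReal.ofReal_lt_one,
      Real.exp_lt_one_iff]
    nlinarith [sq_pos_of_pos ha]
  filter_upwards [ae_tendsto_pow_mul_lintegral_prod hXm hXi hXQ ν hsm hκ hC,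
    ae_tendsto_frequency hXm hXi hXQ hG] with ω h1 h2
  refine tendsto_of_tendsto_of_tendsto_of_le_of_le' tendsto_const_nhds h1
    (Eventually.of_forall fun _ => zero_le) ?_
  have h3 := h2.eventually (Iio_mem_nhds (show Q.real G < p + a by linarith))
  filter_upwards [h3, eventually_gt_atTop 0] with n hn hn0
  have hn0' : (0 : ℝ) < n := by exact_mod_cast hn0
  rw [div_lt_iff₀ hn0'] at hn
  refine mul_le_mul' le_rfl (lintegral_mono fun θ => ?_)
  have : ∏ i ∈ Finset.range n, s θ (X i ω) = ENNReal.ofReal (Real.exp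
      (∑ i ∈ Finset.range n, w (X i ω))) * ∏ i ∈ Finset.range n, r θ (X i ω) := by
    simp only [hs]
    rw [Finset.prod_mul_distrib, Real.exp_sum, ENNReal.ofReal_prod_of_nonneg
      fun _ _ => Real.exp_nonneg _]
  rw [this]
  refine le_mul_of_one_le_left zero_le ?_
  rw [ENNReal.one_le_ofReal, Real.one_le_exp_iff]
  simp only [hw]
  rw [← Finset.mul_sum, Finset.sum_sub_distrib, Finset.sum_const, Finset.card_range, nsmul_eq_mul]
  refine mul_nonneg ha.le ?_
  linarith

theorem bayesPosterior_univ_le_one (prior : Measure T) (L : T → ℝ≥0∞) :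
    bayesPosterior prior L univ ≤ 1 := by
  simp only [bayesPosterior, Measure.smul_apply, withDensity_apply _ MeasurableSet.univ,
    Measure.restrict_univ, smul_eq_mul]
  exact ENNReal.inv_mul_le_one _

/-- A factor free of the parameter cancels in Bayes' formula. The identity is needed only almost
everywhere, so parameters with nonpositive scale can be ignored. -/
theorem bayesPosterior_apply_of_ae_eq_const_mul {prior : Measure T} {L M : T → ℝ≥0∞}
    (hM : Measurable M) {c : ℝ≥0∞} (hc0 : c ≠ 0) (hc : c ≠ ∞) (hLM : ∀ᵐ t ∂prior, L t = c * M t)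
    {A : Set T} (hA : MeasurableSet A) :
    bayesPosterior prior L A = (∫⁻ t, M t ∂prior)⁻¹ * ∫⁻ t in A, M t ∂prior := by
  simp only [bayesPosterior, Measure.smul_apply, withDensity_apply _ hA, smul_eq_mul]
  rw [lintegral_congr_ae hLM, setLIntegral_congr_fun_ae hA (hLM.mono fun t h _ => h),
    lintegral_const_mul _ hM, lintegral_const_mul _ hM, ENNReal.mul_inv (.inl hc0) (.inl hc)]
  rw [mul_mul_mul_comm, ENNReal.inv_mul_cancel hc0 hc, one_mul]

end Abstract

/-- Closeness of two monotone functions on a fine grid is uniform if one of them is continuous. -/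
theorem exists_finset_monotoneOn_close {a b : ℝ} (hab : a < b) {F₀ : ℝ → ℝ}
    (hF₀ : ContinuousOn F₀ (Icc a b)) {η : ℝ} (hη : 0 < η) :
    ∃ S : Finset ℝ, (∀ t ∈ S, t ∈ Icc a b) ∧ ∀ F : ℝ → ℝ, MonotoneOn F (Icc a b) →
      (∀ t ∈ S, |F t - F₀ t| < η) → ∀ x ∈ Icc a b, |F x - F₀ x| < 2 * η := by
  have hu := isCompact_Icc.uniformContinuousOn_of_continuous hF₀
  obtain ⟨d, hd, hdF⟩ := Metric.uniformContinuousOn_iff.1 hu η hη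
  obtain ⟨N, hN⟩ := exists_nat_gt ((b - a) / d)
  have hN0 : (0 : ℝ) < N := lt_trans (div_pos (sub_pos.2 hab) hd) hN
  set h := (b - a) / N with hh
  have hh0 : 0 < h := div_pos (sub_pos.2 hab) hN0
  have hhd : h < d := by
    rw [hh, div_lt_iff₀ hN0]; rw [div_lt_iff₀ hd] at hN; linarith
  have hNh : N * h = b - a := by rw [hh]; field_simp
  have hmem : ∀ k : ℕ, k ≤ N → a + k * h ∈ Icc a b := by
    intro k hk
    have : (k : ℝ) ≤ N := by exact_mod_cast hk
    constructor
    · nlinarith [mul_nonneg k.cast_nonneg hh0.le]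
    · nlinarith
  refine ⟨(Finset.range (N + 1)).image fun k : ℕ => a + k * h, ?_, ?_⟩
  · intro t ht
    obtain ⟨k, hk, rfl⟩ := Finset.mem_image.1 ht
    exact hmem k (by simpa [Nat.lt_succ_iff] using hk)
  intro F hF hS x hx
  -- The cell containing `x`; at `x = b` the floor would overshoot, so the last cell is taken.
  -- Between its endpoints `F` is squeezed, losing `η` from the grid and `η` from the oscillation of
  -- `F₀`.
  have key : ∃ k : ℕ, k + 1 ≤ N ∧ a + k * h ≤ x ∧ x ≤ a + (k + 1 : ℕ) * h := by
    rcases eq_or_lt_of_le hx.2 with rfl | hxb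
    · obtain ⟨M, rfl⟩ : ∃ M, N = M + 1 := Nat.exists_eq_succ_of_ne_zero (by
        rintro rfl; simp at hN0)
      refine ⟨M, le_rfl, ?_, by rw [hNh]; linarith⟩
      push_cast at hNh; linarith
    · refine ⟨⌊(x - a) / h⌋₊, ?_, ?_, ?_⟩
      · rw [Nat.succ_le_iff, Nat.floor_lt (div_nonneg (by linarith [hx.1]) hh0.le),
          div_lt_iff₀ hh0]
        linarith
      · have := Nat.floor_le (div_nonneg (sub_nonneg.2 hx.1) hh0.le)
        rw [le_div_iff₀ hh0] at this
        linarith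
      · have := Nat.lt_floor_add_one ((x - a) / h)
        rw [div_lt_iff₀ hh0] at this
        push_cast; linarith
  obtain ⟨k, hk, h1, h2⟩ := key
  have hm1 := hmem k (by omega)
  have hm2 := hmem (k + 1) hk
  have hs1 := abs_lt.1 (hS _ (Finset.mem_image.2 ⟨k, by simp; omega, rfl⟩))
  have hs2 := abs_lt.1 (hS _ (Finset.mem_image.2 ⟨k + 1, by simp; omega, rfl⟩))
  have e : a + ((k + 1 : ℕ) : ℝ) * h = a + k * h + h := by push_cast; ring
  have hd1 := abs_lt.1 (hdF _ hx _ hm1 (by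
    rw [Real.dist_eq, abs_lt]; constructor <;> linarith))
  have hd2 := abs_lt.1 (hdF _ hx _ hm2 (by
    rw [Real.dist_eq, abs_lt]; constructor <;> linarith))
  have f1 := hF hm1 hx h1
  have f2 := hF hx hm2 h2
  rw [abs_lt]; constructor <;> linarith

/-! ### The standard normal c.d.f. and its quantile function -/

theorem stdNormalCDF_eq_integral (x : ℝ) :
    stdNormalCDF x = ∫ y in Iic x, gaussianPDFReal 0 1 y := by
  have h := ofReal_cdf (gaussianReal 0 1) x
  rw [gaussianReal_apply_eq_integral 0 one_ne_zero,
    ENNReal.ofReal_eq_ofReal_iff (cdf_nonneg _ _)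
      (integral_nonneg fun y => gaussianPDFReal_nonneg _ _ _)] at h
  exact h

theorem continuous_gaussianPDFReal (m : ℝ) (v : ℝ≥0) : Continuous (gaussianPDFReal m v) := by
  unfold gaussianPDFReal
  fun_prop

theorem hasDerivAt_stdNormalCDF (x : ℝ) :
    HasDerivAt stdNormalCDF (gaussianPDFReal 0 1 x) x := by
  have hc := continuous_gaussianPDFReal 0 1
  have hi := integrable_gaussianPDFReal 0 1
  have h : stdNormalCDF = fun u => stdNormalCDF 0 + ∫ y in (0 : ℝ)..u, gaussianPDFReal 0 1 y := by
    ext u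
    rw [← intervalIntegral.integral_Iic_sub_Iic hi.integrableOn hi.integrableOn,
      stdNormalCDF_eq_integral, stdNormalCDF_eq_integral]
    ring
  rw [h]
  exact (intervalIntegral.integral_hasDerivAt_right (hc.intervalIntegrable _ _)
    (hc.stronglyMeasurableAtFilter _ _) hc.continuousAt).const_add _

theorem strictMono_stdNormalCDF : StrictMono stdNormalCDF :=
  strictMono_of_deriv_pos fun x => by
    rw [(hasDerivAt_stdNormalCDF x).deriv]
    exact gaussianPDFReal_pos _ _ _ one_ne_zero

theorem continuous_stdNormalCDF : Continuous stdNormalCDF :=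
  continuous_iff_continuousAt.2 fun x => (hasDerivAt_stdNormalCDF x).continuousAt

theorem stdNormalQuantile_stdNormalCDF (y : ℝ) : stdNormalQuantile (stdNormalCDF y) = y := by
  have : {x : ℝ | stdNormalCDF y ≤ stdNormalCDF x} = Ici y := by
    ext x; simp [strictMono_stdNormalCDF.le_iff_le]
  rw [stdNormalQuantile, this, csInf_Ici]

/-- Points near `stdNormalCDF y` are themselves values of the c.d.f., by the intermediate value
theorem, so there the infimum defining the quantile is a true inverse. -/
theorem continuousAt_stdNormalQuantile (y : ℝ) :
    ContinuousAt stdNormalQuantile (stdNormalCDF y) := by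
  rw [Metric.continuousAt_iff']
  intro ε hε
  have h1 : stdNormalCDF (y - ε) < stdNormalCDF y := strictMono_stdNormalCDF (by linarith)
  have h2 : stdNormalCDF y < stdNormalCDF (y + ε) := strictMono_stdNormalCDF (by linarith)
  filter_upwards [Ioo_mem_nhds h1 h2] with p hp
  obtain ⟨z, -, rfl⟩ := intermediate_value_Ioo (by linarith : y - ε ≤ y + ε)
    continuous_stdNormalCDF.continuousOn hp
  rw [stdNormalQuantile_stdNormalCDF, stdNormalQuantile_stdNormalCDF, Real.dist_eq, abs_lt]
  have h3 := strictMono_stdNormalCDF.lt_iff_lt.1 hp.1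
  have h4 := strictMono_stdNormalCDF.lt_iff_lt.1 hp.2
  constructor <;> linarith

theorem gaussianReal_Iic {m σ : ℝ} (hσ : 0 < σ) (y : ℝ) :
    gaussianReal m (Real.toNNReal (σ ^ 2)) (Iic y)
      = ENNReal.ofReal (stdNormalCDF ((y - m) / σ)) := by
  have h : gaussianReal m (Real.toNNReal (σ ^ 2))
      = ((gaussianReal 0 1).map (σ * ·)).map (m + ·) := by
    rw [gaussianReal_map_const_mul, gaussianReal_map_const_add]
    congr 1
    · simp
    · ext; simp [sq_nonneg]
  rw [h, Measure.map_apply (by fun_prop) measurableSet_Iic,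
    Measure.map_apply (by fun_prop) (measurableSet_Iic.preimage (by fun_prop)),
    stdNormalCDF, ofReal_cdf]
  congr 1
  ext x
  simp only [mem_preimage, mem_Iic]
  rw [le_div_iff₀ hσ]
  constructor <;> intro h <;> linarith

/-! ### Density and c.d.f. of the model on the unit interval -/

theorem hasDerivAt_modelCDF (θ : Param) {x : ℝ} (hx : x ∈ Ioo (0 : ℝ) 1) :
    HasDerivAt (modelCDF θ) (modelPDF θ x) x := by
  have hf : HasDerivAt θ.2.1 (deriv θ.2.1 x) x :=
    ((θ.2.2.contDiffOn.differentiableOn one_ne_zero).differentiableAt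
      (isOpen_Ioo.mem_nhds hx)).hasDerivAt
  have h : HasDerivAt (modelCDF θ) _ x :=
    (hasDerivAt_stdNormalCDF ((θ.2.1 x - θ.1.1) / θ.1.2)).comp x
      ((hf.sub_const θ.1.1).div_const θ.1.2)
  exact h.congr_deriv (by rw [modelPDF]; ring)

theorem continuousOn_deriv_transformation (f : Transformation) :
    ContinuousOn (deriv f.1) (Ioo 0 1) :=
  f.2.contDiffOn.continuousOn_deriv_of_isOpen isOpen_Ioo le_rfl

theorem continuousOn_modelPDF (θ : Param) : ContinuousOn (modelPDF θ) (Ioo 0 1) := by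
  have h1 : ContinuousOn θ.2.1 (Ioo 0 1) := θ.2.2.contDiffOn.continuousOn
  have h2 := (continuous_gaussianPDFReal 0 1).comp_continuousOn
    ((h1.sub continuousOn_const).div_const θ.1.2 : ContinuousOn (fun x => (θ.2.1 x - θ.1.1) / θ.1.2) _)
  exact (h2.div_const _).mul (continuousOn_deriv_transformation θ.2)

theorem deriv_transformation_nonneg (f : Transformation) {x : ℝ} (hx : x ∈ Ioo (0 : ℝ) 1) :
    0 ≤ deriv f.1 x := by
  rw [← derivWithin_of_mem_nhds (isOpen_Ioo.mem_nhds hx)]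
  exact f.2.strictMonoOn.monotoneOn.derivWithin_nonneg

theorem modelPDF_nonneg {θ : Param} (hθ : 0 < θ.1.2) {x : ℝ} (hx : x ∈ Ioo (0 : ℝ) 1) :
    0 ≤ modelPDF θ x :=
  mul_nonneg (div_nonneg (gaussianPDFReal_nonneg _ _ _) hθ.le) (deriv_transformation_nonneg _ hx)

theorem strictMonoOn_modelCDF {θ : Param} (hθ : 0 < θ.1.2) :
    StrictMonoOn (modelCDF θ) (Ioo 0 1) := fun x hx y hy hxy => by
  refine strictMono_stdNormalCDF ?_
  have := θ.2.2.strictMonoOn hx hy hxy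
  gcongr

theorem continuousOn_modelCDF (θ : Param) : ContinuousOn (modelCDF θ) (Ioo 0 1) :=
  fun _ hx => (hasDerivAt_modelCDF θ hx).continuousAt.continuousWithinAt

theorem lintegral_modelPDF {θ : Param} (hθ : 0 < θ.1.2) {a b : ℝ} (ha : 0 < a) (hab : a ≤ b)
    (hb : b < 1) :
    ∫⁻ x in Icc a b, ENNReal.ofReal (modelPDF θ x)
      = ENNReal.ofReal (modelCDF θ b - modelCDF θ a) := by
  have hsub : Icc a b ⊆ Ioo (0 : ℝ) 1 := fun x hx => ⟨ha.trans_le hx.1, hx.2.trans_lt hb⟩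
  have hc : ContinuousOn (modelPDF θ) (Icc a b) := (continuousOn_modelPDF θ).mono hsub
  rw [← ofReal_integral_eq_lintegral_ofReal hc.integrableOn_Icc
    ((ae_restrict_mem measurableSet_Icc).mono fun x hx => modelPDF_nonneg hθ (hsub hx)),
    integral_Icc_eq_integral_Ioc, ← intervalIntegral.integral_of_le hab,
    intervalIntegral.integral_eq_sub_of_hasDerivAt
      (fun x hx => hasDerivAt_modelCDF θ (hsub (by rwa [uIcc_of_le hab] at hx)))
      (hc.intervalIntegrable_of_Icc hab)]

/-! ### The truncated model: bounds, measurability and likelihood ratios -/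

section Truncation

variable {δ : ℝ}

theorem Icc_subset_unit (hδ : 0 < δ) : Icc δ (1 - δ) ⊆ Ioo (0 : ℝ) 1 :=
  fun _ hx => ⟨hδ.trans_le hx.1, hx.2.trans_lt (by linarith)⟩

theorem modelMass_pos (hδ : 0 < δ) (hδ1 : δ < 1 / 4) {θ : Param} (hθ : 0 < θ.1.2) :
    0 < modelCDF θ (1 - δ) - modelCDF θ δ :=
  sub_pos.2 (strictMonoOn_modelCDF hθ ⟨hδ, by linarith⟩ ⟨by linarith, by linarith⟩ (by linarith))

theorem modelCDF_mem_Icc (θ : Param) (x : ℝ) : modelCDF θ x ∈ Icc (0 : ℝ) 1 :=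
  ⟨cdf_nonneg _ _, cdf_le_one _ _⟩

theorem truncPDF_nonneg (hδ : 0 < δ) (hδ1 : δ < 1 / 4) {θ : Param} (hθ : 0 < θ.1.2) {x : ℝ}
    (hx : x ∈ Icc δ (1 - δ)) : 0 ≤ truncPDF δ θ x :=
  div_nonneg (modelPDF_nonneg hθ (Icc_subset_unit hδ hx)) (modelMass_pos hδ hδ1 hθ).le

theorem truncPDF_pos (hδ : 0 < δ) (hδ1 : δ < 1 / 4) {θ : Param} (hθ : 0 < θ.1.2) {x : ℝ}
    (hx : 0 < deriv θ.2.1 x) : 0 < truncPDF δ θ x :=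
  div_pos (mul_pos (div_pos (gaussianPDFReal_pos _ _ _ one_ne_zero) hθ) hx)
    (modelMass_pos hδ hδ1 hθ)

theorem monotoneOn_truncCDF (hδ : 0 < δ) (hδ1 : δ < 1 / 4) {θ : Param} (hθ : 0 < θ.1.2) :
    MonotoneOn (truncCDF δ θ) (Icc δ (1 - δ)) := fun x hx y hy hxy => by
  have h1 := (strictMonoOn_modelCDF hθ).monotoneOn (Icc_subset_unit hδ hx)
    (Icc_subset_unit hδ hy) hxy
  have h2 := modelMass_pos hδ hδ1 hθ
  unfold truncCDF
  gcongr

theorem continuousOn_truncCDF (hδ : 0 < δ) (θ : Param) :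
    ContinuousOn (truncCDF δ θ) (Icc δ (1 - δ)) :=
  (((continuousOn_modelCDF θ).mono (Icc_subset_unit hδ)).sub continuousOn_const).div_const _

theorem truncCDF_mem_Icc (hδ : 0 < δ) (hδ1 : δ < 1 / 4) {θ : Param} (hθ : 0 < θ.1.2) {x : ℝ}
    (hx : x ∈ Icc δ (1 - δ)) : truncCDF δ θ x ∈ Icc (0 : ℝ) 1 := by
  have h2 := modelMass_pos hδ hδ1 hθ
  have hm := (strictMonoOn_modelCDF hθ).monotoneOn
  have hδ' : δ ∈ Icc δ (1 - δ) := ⟨le_rfl, by linarith⟩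
  have hδ'' : 1 - δ ∈ Icc δ (1 - δ) := ⟨by linarith, le_rfl⟩
  have h3 := hm (Icc_subset_unit hδ hδ') (Icc_subset_unit hδ hx) hx.1
  have h4 := hm (Icc_subset_unit hδ hx) (Icc_subset_unit hδ hδ'') hx.2
  refine ⟨div_nonneg (by linarith) h2.le, ?_⟩
  rw [truncCDF, div_le_one h2]
  linarith

theorem measurable_transformation_apply (x : ℝ) : Measurable fun f : Transformation => f.1 x :=
  (measurable_pi_apply x).comp measurable_subtype_coe

/-- The σ-algebra is generated by evaluations, and the derivative is a pointwise limit of difference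
quotients. -/
theorem measurable_transformation_deriv {x : ℝ} (hx : x ∈ Ioo (0 : ℝ) 1) :
    Measurable fun f : Transformation => deriv f.1 x := by
  have ht0 : Tendsto (fun n : ℕ => 1 / ((n : ℝ) + 1)) atTop (𝓝[≠] 0) :=
    tendsto_nhdsWithin_iff.2 ⟨tendsto_one_div_add_atTop_nhds_zero_nat,
      Eventually.of_forall fun n => (Nat.one_div_pos_of_nat (α := ℝ)).ne'⟩
  refine measurable_of_tendsto_metrizable (f := fun (n : ℕ) (f : Transformation) =>
    (1 / ((n : ℝ) + 1))⁻¹ • (f.1 (x + 1 / ((n : ℝ) + 1)) - f.1 x)) (fun n => ?_) ?_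
  · simp only [smul_eq_mul]
    exact ((measurable_transformation_apply _).sub (measurable_transformation_apply _)).const_mul _
  · rw [tendsto_pi_nhds]
    intro f
    have hf : HasDerivAt f.1 (deriv f.1 x) x :=
      ((f.2.contDiffOn.differentiableOn one_ne_zero).differentiableAt
        (isOpen_Ioo.mem_nhds hx)).hasDerivAt
    exact (hasDerivAt_iff_tendsto_slope_zero.1 hf).comp ht0

theorem measurable_modelCDF (x : ℝ) : Measurable fun θ : Param => modelCDF θ x := by
  have : Measurable fun θ : Param => θ.2.1 x :=
    (measurable_transformation_apply x).comp measurable_snd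
  refine continuous_stdNormalCDF.measurable.comp ?_
  exact (this.sub (measurable_fst.comp measurable_fst)).div (measurable_snd.comp measurable_fst)

theorem measurable_truncCDF (x : ℝ) : Measurable fun θ : Param => truncCDF δ θ x :=
  ((measurable_modelCDF x).sub (measurable_modelCDF δ)).div
    ((measurable_modelCDF (1 - δ)).sub (measurable_modelCDF δ))

/-- Carathéodory's criterion: continuous in `x`, measurable in `f`. The subtype `Icc δ (1 - δ)` is
used because `f` is unconstrained outside `(0, 1)`, so continuity may fail there. -/
theorem measurable_truncPDF (hδ : 0 < δ) :
    Measurable fun p : Icc δ (1 - δ) × Param => truncPDF δ p.2 p.1 := by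
  have h1 : Measurable (Function.uncurry
      fun (x : Icc δ (1 - δ)) (f : Transformation) => f.1 x) :=
    measurable_uncurry_of_continuous_of_measurable
      (fun f => (f.2.contDiffOn.continuousOn.mono (Icc_subset_unit hδ)).domRestrict)
      (fun x => measurable_transformation_apply x)
  have h2 : Measurable (Function.uncurry
      fun (x : Icc δ (1 - δ)) (f : Transformation) => deriv f.1 x) :=
    measurable_uncurry_of_continuous_of_measurable
      (fun f => ((continuousOn_deriv_transformation f).mono (Icc_subset_unit hδ)).domRestrict)
      (fun x => measurable_transformation_deriv (Icc_subset_unit hδ x.2))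
  have hp : Measurable fun p : Icc δ (1 - δ) × Param => (p.1, p.2.2) := by fun_prop
  have hμ : Measurable fun p : Icc δ (1 - δ) × Param => p.2.1.1 := by fun_prop
  have hσ : Measurable fun p : Icc δ (1 - δ) × Param => p.2.1.2 := by fun_prop
  have h3 : Measurable fun p : Icc δ (1 - δ) × Param => modelPDF p.2 p.1 :=
    (((continuous_gaussianPDFReal 0 1).measurable.comp
      (((h1.comp hp).sub hμ).div hσ)).div hσ).mul (h2.comp hp)
  exact h3.div (((measurable_modelCDF (1 - δ)).sub (measurable_modelCDF δ)).comp measurable_snd)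

open Classical in
/-- The ratio of the densities of an observation under `θ` and `θ₀`, when the law outside
`[δ, 1 - δ]` and the mass of that interval are the same for both. -/
noncomputable def truncRatio (δ : ℝ) (θ₀ θ : Param) (x : ℝ) : ℝ≥0∞ :=
  if x ∈ Icc δ (1 - δ) then ENNReal.ofReal (truncPDF δ θ x / truncPDF δ θ₀ x) else 1

/-- Carries joint measurability from the subtype to all of `ℝ`. -/
theorem exists_measurable_retraction {a b : ℝ} (hab : a ≤ b) :
    ∃ φ : ℝ → Icc a b, Measurable φ ∧ ∀ x ∈ Icc a b, (φ x : ℝ) = x :=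
  ⟨projIcc a b hab, continuous_projIcc.measurable, fun _ hx => by rw [projIcc_of_mem _ hx]⟩

theorem measurable_truncPDF_comp {α : Type*} [MeasurableSpace α] (hδ : 0 < δ)
    {φ : α → Icc δ (1 - δ)} (hφ : Measurable φ) {ψ : α → Param} (hψ : Measurable ψ) :
    Measurable fun a => truncPDF δ (ψ a) (φ a) := by
  have h := Measurable.comp (measurable_truncPDF hδ) (hφ.prodMk hψ)
  simpa only [Function.comp_def] using h

theorem measurable_truncRatio (hδ : 0 < δ) (hδ1 : δ < 1 / 4) (θ₀ : Param) :
    Measurable (Function.uncurry (truncRatio δ θ₀)) := by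
  classical
  obtain ⟨φ, hφ, hφx⟩ := exists_measurable_retraction (by linarith : δ ≤ 1 - δ)
  have hφ2 : Measurable fun p : Param × ℝ => φ p.2 := hφ.comp measurable_snd
  have h1 : Measurable fun p : Param × ℝ =>
      ENNReal.ofReal (truncPDF δ p.1 (φ p.2) / truncPDF δ θ₀ (φ p.2)) := by
    have ha := measurable_truncPDF_comp hδ hφ2 measurable_fst
    have hb := measurable_truncPDF_comp hδ hφ2 (measurable_const (a := θ₀))
    exact (ha.div hb).ennreal_ofReal
  have hS : MeasurableSet {p : Param × ℝ | p.2 ∈ Icc δ (1 - δ)} :=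
    measurableSet_Icc.preimage measurable_snd
  have h4 : Function.uncurry (truncRatio δ θ₀) = fun p : Param × ℝ =>
      if p.2 ∈ Icc δ (1 - δ) then
        ENNReal.ofReal (truncPDF δ p.1 (φ p.2) / truncPDF δ θ₀ (φ p.2)) else 1 := by
    ext ⟨θ, x⟩
    by_cases hx : x ∈ Icc δ (1 - δ)
    · simp only [Function.uncurry, truncRatio, if_pos hx, hφx x hx]
    · simp only [Function.uncurry, truncRatio, if_neg hx]
  rw [h4]
  exact Measurable.ite hS h1 measurable_const

/-- The likelihood is, up to a factor free of the parameter, a product of density ratios. -/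
theorem truncLikelihood_eq (hδ : 0 < δ) (hδ1 : δ < 1 / 4) {θ₀ : Param} (hθ₀ : 0 < θ₀.1.2)
    (hf₀ : ∀ x ∈ Icc δ (1 - δ), 0 < deriv θ₀.2.1 x) {θ : Param} (hθ : 0 < θ.1.2) (x : ℕ → ℝ)
    (n : ℕ) :
    truncLikelihood δ x n θ = truncLikelihood δ x n θ₀ *
      ∏ i ∈ Finset.range n, truncRatio δ θ₀ θ (x i) := by
  classical
  have h : ∏ i ∈ Finset.range n, truncRatio δ θ₀ θ (x i)
      = ∏ i ∈ complying δ x n, ENNReal.ofReal (truncPDF δ θ (x i) / truncPDF δ θ₀ (x i)) := by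
    simp only [complying, Finset.prod_filter]
    refine Finset.prod_congr rfl fun i _ => ?_
    simp only [truncRatio, mem_Icc]
  have hmem : ∀ i ∈ complying δ x n, x i ∈ Icc δ (1 - δ) := by
    intro i hi
    simp only [complying, Finset.mem_filter] at hi
    exact hi.2
  rw [h, truncLikelihood, truncLikelihood,
    ENNReal.ofReal_prod_of_nonneg fun i hi => truncPDF_nonneg hδ hδ1 hθ (hmem i hi),
    ENNReal.ofReal_prod_of_nonneg fun i hi => truncPDF_nonneg hδ hδ1 hθ₀ (hmem i hi),
    ← Finset.prod_mul_distrib]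
  refine Finset.prod_congr rfl fun i hi => ?_
  have hp := truncPDF_pos hδ hδ1 hθ₀ (hf₀ _ (hmem i hi))
  rw [← ENNReal.ofReal_mul hp.le, mul_div_cancel₀ _ hp.ne']

theorem truncLikelihood_ne_zero (hδ : 0 < δ) (hδ1 : δ < 1 / 4) {θ₀ : Param} (hθ₀ : 0 < θ₀.1.2)
    (hf₀ : ∀ x ∈ Icc δ (1 - δ), 0 < deriv θ₀.2.1 x) (x : ℕ → ℝ) (n : ℕ) :
    truncLikelihood δ x n θ₀ ≠ 0 := by
  rw [truncLikelihood, Ne, ENNReal.ofReal_eq_zero, not_le]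
  refine Finset.prod_pos fun i hi => truncPDF_pos hδ hδ1 hθ₀ (hf₀ _ ?_)
  simp only [complying, Finset.mem_filter] at hi
  exact hi.2

end Truncation

/-! ### The law of the observations and the decay of the likelihood of wrong parameters -/

section Law

variable {Ω : Type*} [MeasurableSpace Ω] {P : Measure Ω} {δ : ℝ}

theorem map_apply_eq_of_transformation {f : Transformation} {Y : Ω → ℝ} (hY : Measurable Y)
    (hmem : ∀ᵐ ω ∂P, Y ω ∈ Ioo (0 : ℝ) 1) {ν : Measure ℝ}
    (hlaw : HasLaw (fun ω => f.1 (Y ω)) ν P) {A B : Set ℝ} (hA : MeasurableSet A)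
    (hB : MeasurableSet B) (hAB : ∀ x ∈ Ioo (0 : ℝ) 1, (x ∈ A ↔ f.1 x ∈ B)) :
    P.map Y A = ν B := by
  rw [Measure.map_apply hY hA, ← hlaw.map_eq, Measure.map_apply_of_aemeasurable hlaw.aemeasurable hB]
  refine measure_congr ?_
  filter_upwards [hmem] with ω hω
  exact propext (hAB _ hω)

/-- Strict monotonicity turns `{Y ≤ t}` into `{f Y ≤ f t}` when `t ∈ (0, 1)`; other `t` give trivial
events. Surjectivity of `f` onto `ℝ` is not needed. -/
theorem map_eq_of_transformation [IsProbabilityMeasure P] {f : Transformation} {Y Z : Ω → ℝ} (hY : Measurable Y)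
    (hYmem : ∀ᵐ ω ∂P, Y ω ∈ Ioo (0 : ℝ) 1) (hZ : Measurable Z)
    (hZmem : ∀ᵐ ω ∂P, Z ω ∈ Ioo (0 : ℝ) 1) {ν : Measure ℝ}
    (hYlaw : HasLaw (fun ω => f.1 (Y ω)) ν P) (hZlaw : HasLaw (fun ω => f.1 (Z ω)) ν P) :
    P.map Y = P.map Z := by
  have := Measure.isProbabilityMeasure_map (μ := P) hY.aemeasurable
  refine Measure.ext_of_Iic _ _ fun t => ?_
  rcases le_or_gt t 0 with h0 | h0
  · have : ∀ x ∈ Ioo (0 : ℝ) 1, (x ∈ Iic t ↔ f.1 x ∈ (∅ : Set ℝ)) := fun x hx =>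
      ⟨fun h => absurd (lt_of_lt_of_le hx.1 h) (not_lt.2 h0), fun h => h.elim⟩
    rw [map_apply_eq_of_transformation hY hYmem hYlaw measurableSet_Iic MeasurableSet.empty this,
      map_apply_eq_of_transformation hZ hZmem hZlaw measurableSet_Iic MeasurableSet.empty this]
  rcases lt_or_ge t 1 with h1 | h1
  · have : ∀ x ∈ Ioo (0 : ℝ) 1, (x ∈ Iic t ↔ f.1 x ∈ Iic (f.1 t)) := fun x hx =>
      (f.2.strictMonoOn.le_iff_le hx ⟨h0, h1⟩).symm
    rw [map_apply_eq_of_transformation hY hYmem hYlaw measurableSet_Iic measurableSet_Iic this,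
      map_apply_eq_of_transformation hZ hZmem hZlaw measurableSet_Iic measurableSet_Iic this]
  · have : ∀ x ∈ Ioo (0 : ℝ) 1, (x ∈ Iic t ↔ f.1 x ∈ (univ : Set ℝ)) := fun x hx =>
      ⟨fun _ => mem_univ _, fun _ => hx.2.le.trans h1⟩
    rw [map_apply_eq_of_transformation hY hYmem hYlaw measurableSet_Iic MeasurableSet.univ this,
      map_apply_eq_of_transformation hZ hZmem hZlaw measurableSet_Iic MeasurableSet.univ this]

theorem map_Icc_eq {θ₀ : Param} (hσ : 0 < θ₀.1.2) {Y : Ω → ℝ} (hY : Measurable Y)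
    (hmem : ∀ᵐ ω ∂P, Y ω ∈ Ioo (0 : ℝ) 1)
    (hlaw : HasLaw (fun ω => θ₀.2.1 (Y ω))
      (gaussianReal θ₀.1.1 (Real.toNNReal (θ₀.1.2 ^ 2))) P)
    {a b : ℝ} (ha : 0 < a) (hab : a ≤ b) (hb : b < 1) :
    P.map Y (Icc a b) = ENNReal.ofReal (modelCDF θ₀ b - modelCDF θ₀ a) := by
  have ha' : a ∈ Ioo (0 : ℝ) 1 := ⟨ha, hab.trans_lt hb⟩
  have hb' : b ∈ Ioo (0 : ℝ) 1 := ⟨ha.trans_le hab, hb⟩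
  have hv : Real.toNNReal (θ₀.1.2 ^ 2) ≠ 0 := by
    rw [Ne, Real.toNNReal_eq_zero, not_le]; positivity
  have := nullSingletonClass_gaussianReal (μ := θ₀.1.1) hv
  have hfab := θ₀.2.2.strictMonoOn.monotoneOn ha' hb' hab
  rw [map_apply_eq_of_transformation hY hmem hlaw measurableSet_Icc
    (measurableSet_Icc (a := θ₀.2.1 a) (b := θ₀.2.1 b)) fun x hx => by
      rw [mem_Icc, mem_Icc, θ₀.2.2.strictMonoOn.le_iff_le ha' hx,
        θ₀.2.2.strictMonoOn.le_iff_le hx hb'],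
    ← measure_congr Ioc_ae_eq_Icc, ← Iic_sdiff_Iic,
    measure_sdiff (Iic_subset_Iic.2 hfab) measurableSet_Iic.nullMeasurableSet (measure_ne_top _ _),
    gaussianReal_Iic hσ, gaussianReal_Iic hσ]
  exact (ENNReal.ofReal_sub _ (modelCDF_mem_Icc θ₀ a).1).symm

theorem restrict_eq_withDensity (hδ : 0 < δ) (hδ1 : δ < 1 / 4) {θ₀ : Param} (hσ : 0 < θ₀.1.2)
    {Q : Measure ℝ} [IsFiniteMeasure Q]
    (hQ : ∀ a b, 0 < a → a ≤ b → b < 1 →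
      Q (Icc a b) = ENNReal.ofReal (modelCDF θ₀ b - modelCDF θ₀ a)) :
    Q.restrict (Icc δ (1 - δ)) = (volume.restrict (Icc δ (1 - δ))).withDensity
      fun x => ENNReal.ofReal (modelPDF θ₀ x) := by
  refine Measure.ext_of_Iic _ _ fun t => ?_
  rw [Measure.restrict_apply measurableSet_Iic, withDensity_apply _ measurableSet_Iic,
    Measure.restrict_restrict measurableSet_Iic]
  rcases lt_or_ge t δ with h | h
  · have : Iic t ∩ Icc δ (1 - δ) = ∅ := by
      ext x; simp only [mem_inter_iff, mem_Iic, mem_Icc, mem_empty_iff_false, iff_false]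
      rintro ⟨h1, h2, -⟩; linarith
    simp [this]
  · have : Iic t ∩ Icc δ (1 - δ) = Icc δ (min t (1 - δ)) := by
      ext x; simp only [mem_inter_iff, mem_Iic, mem_Icc, le_min_iff]; tauto
    have h1 : δ ≤ min t (1 - δ) := le_min h (by linarith)
    have h2 : min t (1 - δ) < 1 := (min_le_right _ _).trans_lt (by linarith)
    rw [this, hQ _ _ hδ h1 h2, lintegral_modelPDF hσ hδ h1 h2]

/-- The density `p_θ₀` of the data cancels the denominator of the ratio, leaving the density `p*_θ`
scaled by the true mass of `[δ, 1 - δ]`. -/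
theorem setLIntegral_truncRatio (hδ : 0 < δ) (hδ1 : δ < 1 / 4) {θ₀ : Param} (hσ : 0 < θ₀.1.2)
    (hf₀ : ∀ x ∈ Icc δ (1 - δ), 0 < deriv θ₀.2.1 x)
    {Q : Measure ℝ} [IsFiniteMeasure Q]
    (hQ : ∀ a b, 0 < a → a ≤ b → b < 1 →
      Q (Icc a b) = ENNReal.ofReal (modelCDF θ₀ b - modelCDF θ₀ a))
    {θ : Param} (hθ : 0 < θ.1.2) {a b : ℝ} (ha : δ ≤ a) (hab : a ≤ b) (hb : b ≤ 1 - δ) :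
    ∫⁻ x in Icc a b, truncRatio δ θ₀ θ x ∂Q = ENNReal.ofReal
      ((modelCDF θ₀ (1 - δ) - modelCDF θ₀ δ) * (truncCDF δ θ b - truncCDF δ θ a)) := by
  have hsub : Icc a b ⊆ Icc δ (1 - δ) := Icc_subset_Icc ha hb
  have hM := modelMass_pos hδ hδ1 hθ
  have hM₀ := modelMass_pos hδ hδ1 hσ
  have hr : Measurable (truncRatio δ θ₀ θ) :=
    (measurable_truncRatio hδ hδ1 θ₀).comp measurable_prodMk_left
  have hd : AEMeasurable (fun x => ENNReal.ofReal (modelPDF θ₀ x)) (volume.restrict (Icc a b)) :=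
    (((continuousOn_modelPDF θ₀).mono (hsub.trans (Icc_subset_unit hδ))).aemeasurable
      measurableSet_Icc).ennreal_ofReal
  have e1 : Q.restrict (Icc a b) = (volume.restrict (Icc a b)).withDensity
      fun x => ENNReal.ofReal (modelPDF θ₀ x) := by
    have h := congrArg (fun μ => Measure.restrict μ (Icc a b))
      (restrict_eq_withDensity hδ hδ1 hσ hQ)
    simpa only [restrict_withDensity measurableSet_Icc,
      Measure.restrict_restrict measurableSet_Icc, inter_eq_left.2 hsub] using h
  rw [e1, lintegral_withDensity_eq_lintegral_mul₀ hd hr.aemeasurable]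
  have e2 : ∀ x ∈ Icc a b, ((fun x => ENNReal.ofReal (modelPDF θ₀ x)) * truncRatio δ θ₀ θ) x =
      ENNReal.ofReal ((modelCDF θ₀ (1 - δ) - modelCDF θ₀ δ) /
        (modelCDF θ (1 - δ) - modelCDF θ δ)) * ENNReal.ofReal (modelPDF θ x) := by
    intro x hx
    have hp : 0 < modelPDF θ₀ x := mul_pos
      (div_pos (gaussianPDFReal_pos _ _ _ one_ne_zero) hσ) (hf₀ x (hsub hx))
    rw [Pi.mul_apply, truncRatio, if_pos (hsub hx), ← ENNReal.ofReal_mul hp.le,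
      ← ENNReal.ofReal_mul (div_pos hM₀ hM).le, truncPDF, truncPDF]
    congr 1
    field_simp
  rw [setLIntegral_congr_fun measurableSet_Icc e2, lintegral_const_mul' _ _ ENNReal.ofReal_ne_top,
    lintegral_modelPDF hθ (hδ.trans_le ha) hab (by linarith),
    ← ENNReal.ofReal_mul (div_pos hM₀ hM).le, truncCDF, truncCDF]
  congr 1
  field_simp
  ring

theorem truncCDF_left (δ : ℝ) (θ : Param) : truncCDF δ θ δ = 0 := by simp [truncCDF]

theorem truncCDF_right (hδ : 0 < δ) (hδ1 : δ < 1 / 4) {θ : Param} (hθ : 0 < θ.1.2) :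
    truncCDF δ θ (1 - δ) = 1 := div_self (modelMass_pos hδ hδ1 hθ).ne'

theorem lintegral_truncRatio (hδ : 0 < δ) (hδ1 : δ < 1 / 4) {θ₀ : Param} (hσ : 0 < θ₀.1.2)
    (hf₀ : ∀ x ∈ Icc δ (1 - δ), 0 < deriv θ₀.2.1 x)
    {Q : Measure ℝ} [IsProbabilityMeasure Q]
    (hQ : ∀ a b, 0 < a → a ≤ b → b < 1 →
      Q (Icc a b) = ENNReal.ofReal (modelCDF θ₀ b - modelCDF θ₀ a))
    {θ : Param} (hθ : 0 < θ.1.2) :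
    ∫⁻ x, truncRatio δ θ₀ θ x ∂Q = 1 := by
  have hle : δ ≤ 1 - δ := by linarith
  rw [← lintegral_add_compl _ (measurableSet_Icc (a := δ) (b := 1 - δ)),
    setLIntegral_truncRatio hδ hδ1 hσ hf₀ hQ hθ le_rfl hle le_rfl, truncCDF_left,
    truncCDF_right hδ hδ1 hθ, sub_zero, mul_one, ← hQ _ _ hδ hle (by linarith),
    setLIntegral_congr_fun (f := truncRatio δ θ₀ θ) (g := fun _ => 1) measurableSet_Icc.compl
      fun x hx => if_neg hx,
    setLIntegral_one, measure_add_measure_compl measurableSet_Icc, measure_univ]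

/-- Parameters whose truncated c.d.f. is off at a point have negligible integrated likelihood. -/
theorem ae_exists_tendsto_lintegral_truncRatio (hδ : 0 < δ) (hδ1 : δ < 1 / 4) {θ₀ : Param}
    (hσ : 0 < θ₀.1.2) (hf₀ : ∀ x ∈ Icc δ (1 - δ), 0 < deriv θ₀.2.1 x)
    {X : ℕ → Ω → ℝ} (hXm : ∀ i, Measurable (X i)) (hXi : iIndepFun X P) {Q : Measure ℝ}
    (hXQ : ∀ i, P.map (X i) = Q)
    (hQ : ∀ a b, 0 < a → a ≤ b → b < 1 →
      Q (Icc a b) = ENNReal.ofReal (modelCDF θ₀ b - modelCDF θ₀ a))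
    (prior : Measure Param) [IsFiniteMeasure prior] {η : ℝ} (hη : 0 < η) :
    ∃ c > 0, ∀ t ∈ Icc δ (1 - δ), ∀ᵐ ω ∂P, Tendsto (fun n : ℕ =>
      ENNReal.ofReal (Real.exp c) ^ n * ∫⁻ θ in {θ | 0 < θ.1.2 ∧
        η ≤ |truncCDF δ θ t - truncCDF δ θ₀ t|},
        ∏ i ∈ Finset.range n, truncRatio δ θ₀ θ (X i ω) ∂prior) atTop (𝓝 0) := by
  have : IsProbabilityMeasure P := hXi.isProbabilityMeasure
  have : IsProbabilityMeasure Q := hXQ 0 ▸ Measure.isProbabilityMeasure_map (hXm 0).aemeasurable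
  have hM₀ := modelMass_pos hδ hδ1 hσ
  set M₀ := modelCDF θ₀ (1 - δ) - modelCDF θ₀ δ with hM₀def
  -- A gap `η` between truncated c.d.f.s is a gap `M₀ * η = 2 * a` in mass. Since `a` does not
  -- depend on `t`, one rate serves the whole grid.
  set a := M₀ * η / 2 with ha_def
  have ha : 0 < a := by positivity
  refine ⟨a ^ 2 / 4, by positivity, fun t ht => ?_⟩
  have hr := measurable_truncRatio hδ hδ1 θ₀
  have hσm : MeasurableSet {θ : Param | 0 < θ.1.2} :=
    measurableSet_lt measurable_const (measurable_snd.comp measurable_fst)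
  have hFm := measurable_truncCDF (δ := δ) t
  have hBm : MeasurableSet ({θ : Param | 0 < θ.1.2} ∩ {θ | truncCDF δ θ₀ t + η ≤ truncCDF δ θ t}) :=
    hσm.inter (measurableSet_le measurable_const hFm)
  have hCm : MeasurableSet ({θ : Param | 0 < θ.1.2} ∩ {θ | truncCDF δ θ t ≤ truncCDF δ θ₀ t - η}) :=
    hσm.inter (measurableSet_le hFm measurable_const)
  have hF₀ := truncCDF_mem_Icc hδ hδ1 hσ ht
  have hval : ∀ {θ : Param}, 0 < θ.1.2 → ∀ {a b : ℝ}, δ ≤ a → a ≤ b → b ≤ 1 - δ →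
      (∫⁻ x in Icc a b, truncRatio δ θ₀ θ x ∂Q).toReal = M₀ * (truncCDF δ θ b - truncCDF δ θ a) := by
    intro θ hθ a b ha hab hb
    rw [setLIntegral_truncRatio hδ hδ1 hσ hf₀ hQ hθ ha hab hb, ENNReal.toReal_ofReal]
    exact mul_nonneg hM₀.le (sub_nonneg.2 (monotoneOn_truncCDF hδ hδ1 hθ ⟨ha, hab.trans hb⟩
      ⟨ha.trans hab, hb⟩ hab))
  have hval₀ : ∀ {a b : ℝ}, δ ≤ a → a ≤ b → b ≤ 1 - δ →
      Q.real (Icc a b) = M₀ * (truncCDF δ θ₀ b - truncCDF δ θ₀ a) := by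
    intro a b ha hab hb
    have h1 := strictMonoOn_modelCDF hσ
    rw [measureReal_def, hQ a b (hδ.trans_le ha) hab (by linarith), ENNReal.toReal_ofReal, truncCDF,
      truncCDF, ← hM₀def]
    · field_simp
      ring
    · exact sub_nonneg.2 (h1.monotoneOn ⟨hδ.trans_le ha, by linarith⟩ ⟨by linarith, by linarith⟩ hab)
  -- If `truncCDF δ θ t` is too large, the excess mass is on `[δ, t]`; if too small, it is on `[t, 1
  -- - δ]`, treated in `h2`.
  have h1 := ae_tendsto_exp_mul_lintegral_prod hXm hXi hXQ (prior.restrict _) hr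
    (measurableSet_Icc (a := δ) (b := t)) ha
    ((ae_restrict_mem hBm).mono fun θ hθ => lintegral_truncRatio hδ hδ1 hσ hf₀ hQ hθ.1)
    ((ae_restrict_mem hBm).mono fun θ hθ => by
      rw [hval hθ.1 le_rfl ht.1 ht.2, hval₀ le_rfl ht.1 ht.2, truncCDF_left, truncCDF_left]
      have := mul_le_mul_of_nonneg_left (show truncCDF δ θ₀ t + η ≤ truncCDF δ θ t from hθ.2) hM₀.le
      rw [ha_def]; linarith)
  have h2 := ae_tendsto_exp_mul_lintegral_prod hXm hXi hXQ (prior.restrict _) hr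
    (measurableSet_Icc (a := t) (b := 1 - δ)) ha
    ((ae_restrict_mem hCm).mono fun θ hθ => lintegral_truncRatio hδ hδ1 hσ hf₀ hQ hθ.1)
    ((ae_restrict_mem hCm).mono fun θ hθ => by
      rw [hval hθ.1 ht.1 ht.2 le_rfl, hval₀ ht.1 ht.2 le_rfl, truncCDF_right hδ hδ1 hθ.1,
        truncCDF_right hδ hδ1 hσ]
      have := mul_le_mul_of_nonneg_left (show truncCDF δ θ t ≤ truncCDF δ θ₀ t - η from hθ.2) hM₀.le
      rw [ha_def]; linarith)
  filter_upwards [h1, h2] with ω h1 h2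
  have h3 := h1.add h2
  rw [add_zero] at h3
  refine tendsto_of_tendsto_of_tendsto_of_le_of_le tendsto_const_nhds h3 (fun _ => zero_le) ?_
  intro n
  dsimp only
  rw [← mul_add]
  refine mul_le_mul' le_rfl ((lintegral_mono_set ?_).trans (lintegral_union_le _ _ _))
  rintro θ ⟨hθ, hd⟩
  rcases le_abs.1 hd with h | h
  · exact .inl ⟨hθ, by rw [mem_ofPred_eq]; linarith⟩
  · exact .inr ⟨hθ, by rw [mem_ofPred_eq]; linarith⟩

end Law

/-! ### Prior mass near the truth and the lower bound for the normalizing integral -/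

variable {δ : ℝ}

theorem abs_sub_lt_of_supDist_lt {f g : ℝ → ℝ} {ε : ℝ} (hε : 0 < ε)
    (h : supDist δ f g < ENNReal.ofReal ε) {x : ℝ} (hx : x ∈ Icc δ (1 - δ)) :
    |f x - g x| < ε :=
  (ENNReal.ofReal_lt_ofReal_iff hε).1
    ((le_iSup₂ (f := fun x (_ : x ∈ Icc δ (1 - δ)) => ENNReal.ofReal |f x - g x|) x hx).trans_lt h)

theorem supDist_lt_of_abs_sub_lt {f g : ℝ → ℝ} {ε : ℝ} (hε : 0 < ε)
    (h : ∀ x ∈ Icc δ (1 - δ), |f x - g x| < ε / 2) : supDist δ f g < ENNReal.ofReal ε :=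
  (iSup₂_le fun x hx => ENNReal.ofReal_le_ofReal (h x hx).le).trans_lt
    ((ENNReal.ofReal_lt_ofReal_iff hε).2 (half_lt_self hε))

/-- Values of a function at points near a compact set of continuity points. -/
theorem exists_pos_dist_lt_of_isCompact {α β : Type*} [PseudoMetricSpace α] [PseudoMetricSpace β]
    {K : Set α} (hK : IsCompact K) {G : α → β} (hG : ∀ a ∈ K, ContinuousAt G a) {ε : ℝ}
    (hε : 0 < ε) : ∃ η > 0, ∀ a ∈ K, ∀ b, dist a b < η → dist (G a) (G b) < ε := by
  obtain ⟨η, hη, h⟩ := Metric.mem_uniformity_dist.1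
    (hK.uniformContinuousAt_of_continuousAt G hG (Metric.dist_mem_uniformity hε))
  exact ⟨η, hη, fun a ha b hab => h hab ha⟩

/-- The truncated density as a function of the parameters and of the values of the transformation
and of its derivative. -/
noncomputable def truncDensityFun (w : (ℝ × ℝ) × (ℝ × ℝ) × (ℝ × ℝ)) : ℝ :=
  gaussianPDFReal 0 1 ((w.2.1.1 - w.1.1) / w.1.2) / w.1.2 * w.2.1.2 /
    (stdNormalCDF ((w.2.2.2 - w.1.1) / w.1.2) - stdNormalCDF ((w.2.2.1 - w.1.1) / w.1.2))

theorem truncDensityFun_eq (θ : Param) (x : ℝ) :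
    truncDensityFun (θ.1, (θ.2.1 x, deriv θ.2.1 x), (θ.2.1 δ, θ.2.1 (1 - δ))) = truncPDF δ θ x :=
  rfl

theorem continuousAt_truncDensityFun {w : (ℝ × ℝ) × (ℝ × ℝ) × (ℝ × ℝ)} (h1 : w.1.2 ≠ 0)
    (h2 : stdNormalCDF ((w.2.2.2 - w.1.1) / w.1.2) - stdNormalCDF ((w.2.2.1 - w.1.1) / w.1.2) ≠ 0) :
    ContinuousAt truncDensityFun w := by
  have hs : ContinuousAt (fun w : (ℝ × ℝ) × (ℝ × ℝ) × (ℝ × ℝ) => w.1.2) w := by fun_prop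
  have ha : ContinuousAt (fun w : (ℝ × ℝ) × (ℝ × ℝ) × (ℝ × ℝ) => (w.2.1.1 - w.1.1) / w.1.2) w :=
    ContinuousAt.div (by fun_prop) hs h1
  have hb : ContinuousAt (fun w : (ℝ × ℝ) × (ℝ × ℝ) × (ℝ × ℝ) => (w.2.2.1 - w.1.1) / w.1.2) w :=
    ContinuousAt.div (by fun_prop) hs h1
  have hc : ContinuousAt (fun w : (ℝ × ℝ) × (ℝ × ℝ) × (ℝ × ℝ) => (w.2.2.2 - w.1.1) / w.1.2) w :=
    ContinuousAt.div (by fun_prop) hs h1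
  have hφ := ((continuous_gaussianPDFReal 0 1).continuousAt
    (x := (w.2.1.1 - w.1.1) / w.1.2)).comp_of_eq ha rfl
  have hb' := (continuous_stdNormalCDF.continuousAt
    (x := (w.2.2.1 - w.1.1) / w.1.2)).comp_of_eq hb rfl
  have hc' := (continuous_stdNormalCDF.continuousAt
    (x := (w.2.2.2 - w.1.1) / w.1.2)).comp_of_eq hc rfl
  exact ContinuousAt.div (ContinuousAt.mul (ContinuousAt.div hφ hs h1) (by fun_prop))
    (hc'.sub hb') h2

/-- `truncDensityFun` is continuous at each point of the compact curve traced by the true parameter,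
which yields a uniform additive bound. Since `f₀' > 0`, the true density has a positive minimum on
the interval, and this converts the additive error into the factor `exp (-c)`. -/
theorem exists_nhds_truncPDF_ge (hδ : 0 < δ) (hδ1 : δ < 1 / 4) {θ₀ : Param}
    (hσ : 0 < θ₀.1.2) (hf₀ : ∀ x ∈ Icc δ (1 - δ), 0 < deriv θ₀.2.1 x) {c : ℝ} (hc : 0 < c) :
    ∃ U ∈ 𝓝 θ₀.1, ∃ ε > 0, ∀ θ : Param, θ.1 ∈ U →
      supDist δ θ.2.1 θ₀.2.1 < ENNReal.ofReal ε →
      supDist δ (deriv θ.2.1) (deriv θ₀.2.1) < ENNReal.ofReal ε →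
      ∀ x ∈ Icc δ (1 - δ), Real.exp (-c) * truncPDF δ θ₀ x ≤ truncPDF δ θ x := by
  have hle : δ ≤ 1 - δ := by linarith
  have hsub := Icc_subset_unit hδ
  have hM := modelMass_pos hδ hδ1 hσ
  have hf : ContinuousOn θ₀.2.1 (Icc δ (1 - δ)) := θ₀.2.2.contDiffOn.continuousOn.mono hsub
  have hf' : ContinuousOn (deriv θ₀.2.1) (Icc δ (1 - δ)) :=
    (continuousOn_deriv_transformation θ₀.2).mono hsub
  set J : ℝ → (ℝ × ℝ) × (ℝ × ℝ) × (ℝ × ℝ) := fun x =>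
    (θ₀.1, (θ₀.2.1 x, deriv θ₀.2.1 x), (θ₀.2.1 δ, θ₀.2.1 (1 - δ))) with hJ
  have hJc : ContinuousOn J (Icc δ (1 - δ)) :=
    continuousOn_const.prodMk ((hf.prodMk hf').prodMk continuousOn_const)
  have hp : ContinuousOn (truncPDF δ θ₀) (Icc δ (1 - δ)) :=
    ((continuousOn_modelPDF θ₀).mono hsub).div_const _
  obtain ⟨x₀, hx₀, hmin⟩ := isCompact_Icc.exists_isMinOn (nonempty_Icc.2 hle) hp
  have hm : 0 < truncPDF δ θ₀ x₀ := truncPDF_pos hδ hδ1 hσ (hf₀ x₀ hx₀)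
  have hexp : Real.exp (-c) < 1 := Real.exp_lt_one_iff.2 (by linarith)
  obtain ⟨ε, hε, hG⟩ := exists_pos_dist_lt_of_isCompact (isCompact_Icc.image_of_continuousOn hJc)
    (G := truncDensityFun) (by
      rintro _ ⟨x, -, rfl⟩
      exact continuousAt_truncDensityFun hσ.ne' hM.ne')
    -- The tolerance `m * (1 - exp (-c))`, with `m` the minimum of the true density, is at most `(1
    -- - exp (-c)) * truncPDF δ θ₀ x`.
    (mul_pos hm (sub_pos.2 hexp))
  refine ⟨Metric.ball θ₀.1 ε, Metric.ball_mem_nhds _ hε, ε, hε, fun θ hU h1 h2 x hx => ?_⟩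
  have hdist : dist (J x) (θ.1, (θ.2.1 x, deriv θ.2.1 x), (θ.2.1 δ, θ.2.1 (1 - δ))) < ε := by
    have hb : ∀ y ∈ Icc δ (1 - δ), dist (θ₀.2.1 y) (θ.2.1 y) < ε := fun y hy => by
      rw [dist_comm, Real.dist_eq]; exact abs_sub_lt_of_supDist_lt hε h1 hy
    have hb' : ∀ y ∈ Icc δ (1 - δ), dist (deriv θ₀.2.1 y) (deriv θ.2.1 y) < ε := fun y hy => by
      rw [dist_comm, Real.dist_eq]; exact abs_sub_lt_of_supDist_lt hε h2 hy
    have hU' : dist θ₀.1 θ.1 < ε := by rw [dist_comm]; exact hU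
    rw [hJ]
    refine max_lt hU' (max_lt (max_lt (hb x hx) (hb' x hx))
      (max_lt (hb _ ⟨le_rfl, hle⟩) (hb _ ⟨hle, le_rfl⟩)))
  have h3 := hG _ (mem_image_of_mem _ hx) _ hdist
  rw [hJ, truncDensityFun_eq, truncDensityFun_eq, Real.dist_eq, abs_lt] at h3
  have h4 : truncPDF δ θ₀ x₀ ≤ truncPDF δ θ₀ x := hmin hx
  nlinarith [mul_le_mul_of_nonneg_right h4 (sub_pos.2 hexp).le, h3.2]

/-- The integrated likelihood ratio decreases more slowly than any exponential. -/
theorem exists_mul_pow_le_lintegral_truncRatio (hδ : 0 < δ) (hδ1 : δ < 1 / 4) {θ₀ : Param}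
    (hσ : 0 < θ₀.1.2) (hf₀ : ∀ x ∈ Icc δ (1 - δ), 0 < deriv θ₀.2.1 x)
    (ρ : Measure (ℝ × ℝ)) (hρ : θ₀.1 ∈ ρ.support)
    (Pf : Measure Transformation) [SFinite Pf]
    (hPf : ∀ ε : ℝ, 0 < ε → 0 < Pf {f | supDist δ f.1 θ₀.2.1 < ENNReal.ofReal ε ∧
        supDist δ (deriv f.1) (deriv θ₀.2.1) < ENNReal.ofReal ε})
    {c : ℝ} (hc : 0 < c) :
    ∃ m : ℝ≥0∞, m ≠ 0 ∧ ∀ (x : ℕ → ℝ) (n : ℕ), ENNReal.ofReal (Real.exp (-c)) ^ n * m ≤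
      ∫⁻ θ, ∏ i ∈ Finset.range n, truncRatio δ θ₀ θ (x i) ∂(ρ.prod Pf) := by
  obtain ⟨U, hU, ε, hε, h⟩ := exists_nhds_truncPDF_ge hδ hδ1 hσ hf₀ hc
  set N := {f : Transformation | supDist δ f.1 θ₀.2.1 < ENNReal.ofReal ε ∧
        supDist δ (deriv f.1) (deriv θ₀.2.1) < ENNReal.ofReal ε} with hN
  refine ⟨ρ U * Pf N, mul_ne_zero ((Measure.mem_support_iff_forall _).1 hρ U hU).ne' (hPf ε hε).ne',
    fun x n => ?_⟩
  have hm : Measurable fun θ => ∏ i ∈ Finset.range n, truncRatio δ θ₀ θ (x i) :=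
    Finset.measurable_fun_prod _ fun i _ =>
      (measurable_truncRatio hδ hδ1 θ₀).comp measurable_prodMk_right
  refine le_trans ?_ (mul_meas_ge_le_lintegral hm (ENNReal.ofReal (Real.exp (-c)) ^ n))
  rw [← Measure.prod_prod]
  refine mul_le_mul' le_rfl (measure_mono ?_)
  rintro θ ⟨h1, h2⟩
  have hi : ∀ i ∈ Finset.range n, ENNReal.ofReal (Real.exp (-c)) ≤ truncRatio δ θ₀ θ (x i) := by
    intro i _
    by_cases hx : x i ∈ Icc δ (1 - δ)
    · rw [truncRatio, if_pos hx]
      refine ENNReal.ofReal_le_ofReal ?_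
      rw [le_div_iff₀ (truncPDF_pos hδ hδ1 hσ (hf₀ _ hx))]
      exact h θ h1 h2.1 h2.2 _ hx
    · rw [truncRatio, if_neg hx, ENNReal.ofReal_le_one, Real.exp_le_one_iff]
      linarith
  rw [mem_ofPred_eq]
  simpa using Finset.prod_le_prod' hi

theorem setLIntegral_biUnion_finset_le {α ι : Type*} [MeasurableSpace α] (μ : Measure α)
    (f : α → ℝ≥0∞) (S : Finset ι) (B : ι → Set α) :
    ∫⁻ x in ⋃ i ∈ S, B i, f x ∂μ ≤ ∑ i ∈ S, ∫⁻ x in B i, f x ∂μ := by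
  classical
  induction S using Finset.induction_on with
  | empty => simp
  | insert i S hi ih =>
    rw [Finset.set_biUnion_insert, Finset.sum_insert hi]
    exact (lintegral_union_le _ _ _).trans (add_le_add_right ih _)

/-! ### Consistency of the posterior of the truncated c.d.f. -/

section Posterior

variable {Ω : Type*} [MeasurableSpace Ω] {P : Measure Ω}

theorem measurableSet_truncCDF_close (δ : ℝ) (θ₀ : Param) (S : Finset ℝ) (η : ℝ) :
    MeasurableSet {θ : Param | 0 < θ.1.2 ∧ ∀ t ∈ S, |truncCDF δ θ t - truncCDF δ θ₀ t| < η} := by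
  have h1 : MeasurableSet {θ : Param | 0 < θ.1.2} :=
    measurableSet_lt measurable_const (measurable_snd.comp measurable_fst)
  have h2 : ∀ t ∈ S, MeasurableSet {θ : Param | |truncCDF δ θ t - truncCDF δ θ₀ t| < η} :=
    fun t _ => measurableSet_lt
      (_root_.continuous_abs.measurable.comp ((measurable_truncCDF t).sub measurable_const))
      measurable_const
  convert h1.inter (S.measurableSet_biInter h2) using 1
  ext θ
  simp

/-- The numerator over the complement, even multiplied by `exp (c n)`, tends to `0`, while the
normalizing integral is at least `m * exp (-c n)` with the same `c`. -/
theorem ae_tendsto_truncPosterior (hδ : 0 < δ) (hδ1 : δ < 1 / 4) {θ₀ : Param}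
    (hσ : 0 < θ₀.1.2) (hf₀ : ∀ x ∈ Icc δ (1 - δ), 0 < deriv θ₀.2.1 x)
    {X : ℕ → Ω → ℝ} (hXm : ∀ i, Measurable (X i)) (hXi : iIndepFun X P) {Q : Measure ℝ}
    (hXQ : ∀ i, P.map (X i) = Q)
    (hQ : ∀ a b, 0 < a → a ≤ b → b < 1 →
      Q (Icc a b) = ENNReal.ofReal (modelCDF θ₀ b - modelCDF θ₀ a))
    (ρ : Measure (ℝ × ℝ)) [IsProbabilityMeasure ρ] (hρpos : ∀ᵐ p ∂ρ, 0 < p.2)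
    (hρ : θ₀.1 ∈ ρ.support)
    (Pf : Measure Transformation) [IsProbabilityMeasure Pf]
    (hPf : ∀ ε : ℝ, 0 < ε → 0 < Pf {f | supDist δ f.1 θ₀.2.1 < ENNReal.ofReal ε ∧
        supDist δ (deriv f.1) (deriv θ₀.2.1) < ENNReal.ofReal ε})
    {S : Finset ℝ} (hS : ∀ t ∈ S, t ∈ Icc δ (1 - δ)) {η : ℝ} (hη : 0 < η) :
    ∀ᵐ ω ∂P, Tendsto (fun n : ℕ => truncPosterior ρ Pf δ (fun i => X i ω) n
      {θ | 0 < θ.1.2 ∧ ∀ t ∈ S, |truncCDF δ θ t - truncCDF δ θ₀ t| < η}) atTop (𝓝 1) := by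
  have : IsProbabilityMeasure P := hXi.isProbabilityMeasure
  have : IsProbabilityMeasure Q := hXQ 0 ▸ Measure.isProbabilityMeasure_map (hXm 0).aemeasurable
  have hr := measurable_truncRatio hδ hδ1 θ₀
  have hpos : ∀ᵐ θ ∂(ρ.prod Pf), 0 < θ.1.2 :=
    Measure.quasiMeasurePreserving_fst.ae hρpos
  obtain ⟨c, hc, hB⟩ := ae_exists_tendsto_lintegral_truncRatio hδ hδ1 hσ hf₀ hXm hXi hXQ hQ
    (ρ.prod Pf) hη
  obtain ⟨m, hm0, hm⟩ := exists_mul_pow_le_lintegral_truncRatio hδ hδ1 hσ hf₀ ρ hρ Pf hPf hc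
  have hfin := ae_lintegral_prod_lt_top hXm hXi hXQ (ρ.prod Pf) hr
    (hpos.mono fun θ hθ => (lintegral_truncRatio hδ hδ1 hσ hf₀ hQ hθ).le)
  have hall := (Finset.eventually_all S).2 fun t ht => hB t (hS t ht)
  set A := {θ : Param | 0 < θ.1.2 ∧ ∀ t ∈ S, |truncCDF δ θ t - truncCDF δ θ₀ t| < η} with hA
  have hAm : MeasurableSet A := measurableSet_truncCDF_close δ θ₀ S η
  filter_upwards [hfin, hall] with ω hω1 hω2
  set M : ℕ → Param → ℝ≥0∞ := fun n θ => ∏ i ∈ Finset.range n, truncRatio δ θ₀ θ (X i ω) with hMdef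
  have hMm : ∀ n, Measurable (M n) := fun n => Finset.measurable_fun_prod _ fun i _ =>
    hr.comp measurable_prodMk_right
  have hD0 : ∀ n, ∫⁻ θ, M n θ ∂(ρ.prod Pf) ≠ 0 := fun n h => by
    have h1 := hm (fun i => X i ω) n
    rw [h, nonpos_iff_eq_zero] at h1
    refine mul_ne_zero (pow_ne_zero _ ?_) hm0 h1
    simp [Real.exp_pos]
  set ratio : ℕ → ℝ≥0∞ := fun n =>
    (∫⁻ θ, M n θ ∂(ρ.prod Pf))⁻¹ * ∫⁻ θ in Aᶜ, M n θ ∂(ρ.prod Pf) with hratio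
  have heq : ∀ n, truncPosterior ρ Pf δ (fun i => X i ω) n A = 1 - ratio n := by
    intro n
    rw [truncPosterior, bayesPosterior_apply_of_ae_eq_const_mul (hMm n)
      (truncLikelihood_ne_zero hδ hδ1 hσ hf₀ _ n) ENNReal.ofReal_ne_top
      (hpos.mono fun θ hθ => truncLikelihood_eq hδ hδ1 hσ hf₀ hθ _ n) hAm]
    have hle : ratio n ≤ 1 := by
      rw [hratio]
      refine (mul_le_mul' le_rfl (setLIntegral_le_lintegral _ _)).trans ?_
      exact ENNReal.inv_mul_le_one _
    refine ENNReal.eq_sub_of_add_eq (ne_top_of_le_ne_top ENNReal.one_ne_top hle) ?_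
    rw [hratio, ← mul_add, lintegral_add_compl _ hAm]
    exact ENNReal.inv_mul_cancel (hD0 n) (hω1 n).ne
  have hlim : Tendsto ratio atTop (𝓝 0) := by
    have hsum : Tendsto (fun n : ℕ => m⁻¹ * ∑ t ∈ S, (ENNReal.ofReal (Real.exp c) ^ n *
        ∫⁻ θ in {θ | 0 < θ.1.2 ∧ η ≤ |truncCDF δ θ t - truncCDF δ θ₀ t|}, M n θ ∂(ρ.prod Pf)))
        atTop (𝓝 0) := by
      have h := tendsto_finsetSum S hω2
      rw [Finset.sum_const_zero] at h
      have h' := ENNReal.Tendsto.const_mul (a := m⁻¹) h (.inr (ENNReal.inv_ne_top.2 hm0))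
      rwa [mul_zero] at h'
    refine tendsto_of_tendsto_of_tendsto_of_le_of_le tendsto_const_nhds hsum (fun _ => zero_le) ?_
    intro n
    have hnum : ∫⁻ θ in Aᶜ, M n θ ∂(ρ.prod Pf) ≤ ∑ t ∈ S, ∫⁻ θ in
        {θ | 0 < θ.1.2 ∧ η ≤ |truncCDF δ θ t - truncCDF δ θ₀ t|}, M n θ ∂(ρ.prod Pf) := by
      refine (lintegral_mono_set' (t := ⋃ t ∈ S, {θ : Param | 0 < θ.1.2 ∧
        η ≤ |truncCDF δ θ t - truncCDF δ θ₀ t|}) ?_).trans ?_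
      -- The complement of `A` also contains the parameters with nonpositive scale, which form a
      -- null set.
      · filter_upwards [hpos] with θ hθ hθA
        have h1 : ¬ (0 < θ.1.2 ∧ ∀ t ∈ S, |truncCDF δ θ t - truncCDF δ θ₀ t| < η) := hθA
        push Not at h1
        obtain ⟨t, ht, h2⟩ := h1 hθ
        exact mem_biUnion (s := (S : Set ℝ)) ht ⟨hθ, h2⟩
      · exact setLIntegral_biUnion_finset_le _ _ _ _
    have hinv : (∫⁻ θ, M n θ ∂(ρ.prod Pf))⁻¹ ≤ m⁻¹ * ENNReal.ofReal (Real.exp c) ^ n := by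
      refine (ENNReal.inv_le_inv.2 (hm (fun i => X i ω) n)).trans (le_of_eq ?_)
      rw [ENNReal.mul_inv (.inr ?_) (.inr hm0), mul_comm, ENNReal.inv_pow, Real.exp_neg,
        ENNReal.ofReal_inv_of_pos (Real.exp_pos _), inv_inv]
      -- The case `n = 0` of the lower bound shows that `m` is finite.
      have h1 := (hm (fun i => X i ω) 0).trans_lt (hω1 0)
      simpa using h1.ne
    dsimp only [hratio]
    rw [← Finset.mul_sum, ← mul_assoc]
    exact mul_le_mul' hinv hnum
  simp only [heq]
  have h := ENNReal.Tendsto.sub (tendsto_const_nhds (x := (1 : ℝ≥0∞))) hlim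
    (.inl ENNReal.one_ne_top)
  rwa [tsub_zero] at h

end Posterior

/-! ### From the c.d.f. back to the parameters -/

/-- The map from `F` to `(μ, σ, f)` is continuous at the truth for uniform convergence. -/
theorem exists_pos_forall_close (hδ : 0 < δ) (hδ1 : δ < 1 / 4) {θ₀ : Param}
    (hσ : 0 < θ₀.1.2) {ε : ℝ} (hε : 0 < ε) :
    ∃ η > 0, ∀ F : ℝ → ℝ, (∀ x ∈ Icc δ (1 - δ), |F x - modelCDF θ₀ x| < η) →
      |locationOf F - θ₀.1.1| < ε ∧ |scaleOf F - θ₀.1.2| < ε ∧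
        supDist δ (transformationOf F) θ₀.2.1 < ENNReal.ofReal ε := by
  have h14 : (1 / 4 : ℝ) ∈ Icc δ (1 - δ) := ⟨by linarith, by linarith⟩
  have h12 : (1 / 2 : ℝ) ∈ Icc δ (1 - δ) := ⟨by linarith, by linarith⟩
  have h34 : (3 / 4 : ℝ) ∈ Icc δ (1 - δ) := ⟨by linarith, by linarith⟩
  set q := stdNormalQuantile with hqdef
  have hq : ∀ x, q (modelCDF θ₀ x) = (θ₀.2.1 x - θ₀.1.1) / θ₀.1.2 := fun x =>
    stdNormalQuantile_stdNormalCDF _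
  have hqc : ∀ x, ContinuousAt q (modelCDF θ₀ x) := fun x => continuousAt_stdNormalQuantile _
  -- The normalization at the quartiles identifies `σ₀`; the one at the median, used in `hGJ`,
  -- identifies `μ₀`.
  have hd : q (modelCDF θ₀ (3 / 4)) - q (modelCDF θ₀ (1 / 4)) = 1 / θ₀.1.2 := by
    rw [hq, hq, ← sub_div, sub_sub_sub_cancel_right, θ₀.2.2.quartiles]
  have hd0 : q (modelCDF θ₀ (3 / 4)) - q (modelCDF θ₀ (1 / 4)) ≠ 0 := by
    rw [hd]; positivity
  set G : ℝ × ℝ × ℝ × ℝ → ℝ × ℝ × ℝ := fun p =>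
    (-q p.2.2.1 / (q p.2.2.2 - q p.2.1), 1 / (q p.2.2.2 - q p.2.1),
      -q p.2.2.1 / (q p.2.2.2 - q p.2.1) + 1 / (q p.2.2.2 - q p.2.1) * q p.1) with hG
  set J : ℝ → ℝ × ℝ × ℝ × ℝ := fun x =>
    (modelCDF θ₀ x, modelCDF θ₀ (1 / 4), modelCDF θ₀ (1 / 2), modelCDF θ₀ (3 / 4)) with hJ
  have hJc : ContinuousOn J (Icc δ (1 - δ)) :=
    ((continuousOn_modelCDF θ₀).mono (Icc_subset_unit hδ)).prodMk continuousOn_const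
  have hGJ : ∀ x, G (J x) = (θ₀.1.1, θ₀.1.2, θ₀.2.1 x) := by
    intro x
    simp only [hG, hJ, hd]
    rw [hq, hq, θ₀.2.2.median]
    simp only [Prod.mk.injEq]
    refine ⟨by field_simp; ring, by field_simp, by field_simp; ring⟩
  have hGc : ∀ a ∈ J '' Icc δ (1 - δ), ContinuousAt G a := by
    rintro _ ⟨x, -, rfl⟩
    have c0 : ContinuousAt (fun p : ℝ × ℝ × ℝ × ℝ => q p.1) (J x) :=
      (hqc x).comp_of_eq (by fun_prop) rfl
    have c1 : ContinuousAt (fun p : ℝ × ℝ × ℝ × ℝ => q p.2.1) (J x) :=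
      (hqc (1 / 4)).comp_of_eq (by fun_prop) rfl
    have c2 : ContinuousAt (fun p : ℝ × ℝ × ℝ × ℝ => q p.2.2.1) (J x) :=
      (hqc (1 / 2)).comp_of_eq (by fun_prop) rfl
    have c3 : ContinuousAt (fun p : ℝ × ℝ × ℝ × ℝ => q p.2.2.2) (J x) :=
      (hqc (3 / 4)).comp_of_eq (by fun_prop) rfl
    have l1 := c2.neg.div (c3.sub c1) hd0
    have l2 := (continuousAt_const (y := (1 : ℝ))).div (c3.sub c1) hd0
    exact l1.prodMk (l2.prodMk (l1.add (l2.mul c0)))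
  obtain ⟨η, hη, h⟩ := exists_pos_dist_lt_of_isCompact (isCompact_Icc.image_of_continuousOn hJc)
    -- Half of `ε`, because the supremum of strict bounds is only a weak bound.
    hGc (half_pos hε)
  refine ⟨η, hη, fun F hF => ?_⟩
  have key : ∀ x ∈ Icc δ (1 - δ), |locationOf F - θ₀.1.1| < ε / 2 ∧ |scaleOf F - θ₀.1.2| < ε / 2 ∧
      |transformationOf F x - θ₀.2.1 x| < ε / 2 := by
    intro x hx
    have hF' : ∀ y ∈ Icc δ (1 - δ), dist (modelCDF θ₀ y) (F y) < η := fun y hy => by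
      rw [dist_comm]; exact hF y hy
    have h1 := h (J x) (mem_image_of_mem _ hx) (F x, F (1 / 4), F (1 / 2), F (3 / 4))
      (max_lt (hF' x hx) (max_lt (hF' _ h14) (max_lt (hF' _ h12) (hF' _ h34))))
    rw [hGJ, dist_comm] at h1
    obtain ⟨a1, a2⟩ := max_lt_iff.1 h1
    obtain ⟨a3, a4⟩ := max_lt_iff.1 a2
    exact ⟨a1, a3, a4⟩
  obtain ⟨k1, k2, -⟩ := key _ h12
  exact ⟨k1.trans (half_lt_self hε), k2.trans (half_lt_self hε),
    supDist_lt_of_abs_sub_lt hε fun x hx => (key x hx).2.2⟩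

/-- The errors in `π⁻` and `π⁺` enter with weights `1 - F*` and `F*`, so together they cost `η`; the
error in `F*` is multiplied by a mass at most `1` and costs another `η`. -/
theorem abs_inducedCDF_sub_lt (hδ : 0 < δ) (hδ1 : δ < 1 / 4) {θ₀ : Param} (hσ : 0 < θ₀.1.2)
    {θ : Param} (hθ : 0 < θ.1.2) {q : ℝ × ℝ} {η : ℝ}
    (h1 : |q.1 - modelCDF θ₀ δ| < η) (h2 : |q.2 - (1 - modelCDF θ₀ (1 - δ))| < η) {x : ℝ}
    (hx : x ∈ Icc δ (1 - δ)) (h3 : |truncCDF δ θ x - truncCDF δ θ₀ x| < η) :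
    |inducedCDF δ (θ, q) x - modelCDF θ₀ x| < 2 * η := by
  have hM := modelMass_pos hδ hδ1 hσ
  have hM1 : modelCDF θ₀ (1 - δ) - modelCDF θ₀ δ ≤ 1 := by
    linarith [(modelCDF_mem_Icc θ₀ (1 - δ)).2, (modelCDF_mem_Icc θ₀ δ).1]
  have hF := truncCDF_mem_Icc hδ hδ1 hθ hx
  have e : modelCDF θ₀ x = modelCDF θ₀ δ +
      (modelCDF θ₀ (1 - δ) - modelCDF θ₀ δ) * truncCDF δ θ₀ x := by
    rw [truncCDF, mul_div_cancel₀ _ hM.ne']; ring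
  have e2 : inducedCDF δ (θ, q) x - modelCDF θ₀ x =
      (q.1 - modelCDF θ₀ δ) * (1 - truncCDF δ θ x) -
      (q.2 - (1 - modelCDF θ₀ (1 - δ))) * truncCDF δ θ x +
      (modelCDF θ₀ (1 - δ) - modelCDF θ₀ δ) * (truncCDF δ θ x - truncCDF δ θ₀ x) := by
    rw [e, inducedCDF]; ring
  have b1 : |(q.1 - modelCDF θ₀ δ) * (1 - truncCDF δ θ x)| ≤ η * (1 - truncCDF δ θ x) := by
    rw [abs_mul, abs_of_nonneg (sub_nonneg.2 hF.2)]
    exact mul_le_mul_of_nonneg_right h1.le (sub_nonneg.2 hF.2)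
  have b2 : |(q.2 - (1 - modelCDF θ₀ (1 - δ))) * truncCDF δ θ x| ≤ η * truncCDF δ θ x := by
    rw [abs_mul, abs_of_nonneg hF.1]
    exact mul_le_mul_of_nonneg_right h2.le hF.1
  have b3 : |(modelCDF θ₀ (1 - δ) - modelCDF θ₀ δ) * (truncCDF δ θ x - truncCDF δ θ₀ x)| < η := by
    rw [abs_mul, abs_of_pos hM]
    exact (mul_le_of_le_one_left (abs_nonneg _) hM1).trans_lt h3
  rw [e2]
  rw [abs_lt] at b3 ⊢
  rw [abs_le] at b1 b2
  constructor <;> linarith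

end Nonparanormal
-- Assembly of the consistency theorem
theorem theorem1
    {Ω : Type*} [MeasurableSpace Ω] (P : Measure Ω) [IsProbabilityMeasure P]
    (δ : ℝ) (hδ0 : 0 < δ) (hδ1 : δ < 1 / 4)
    -- the true parameters
    (μ₀ σ₀ : ℝ) (hσ₀ : 0 < σ₀) (f₀ : Nonparanormal.Transformation)
    (hf₀ : ∀ x ∈ Icc δ (1 - δ), 0 < deriv f₀.1 x)
    -- i.i.d. observations in `(0,1)` with `f₀ X ∼ N(μ₀, σ₀²)`
    (X : ℕ → Ω → ℝ) (hXmeas : ∀ i, Measurable (X i)) (hXindep : iIndepFun X P)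
    (hXmem : ∀ i, ∀ᵐ ω ∂P, X i ω ∈ Ioo (0 : ℝ) 1)
    (hXlaw : ∀ i, HasLaw (fun ω => f₀.1 (X i ω)) (gaussianReal μ₀ (Real.toNNReal (σ₀ ^ 2))) P)
    -- the prior on `(μ, σ)`
    (ρ : Measure (ℝ × ℝ)) [IsProbabilityMeasure ρ] (hρpos : ∀ᵐ p ∂ρ, 0 < p.2)
    (hρ : (μ₀, σ₀) ∈ ρ.support)
    -- the prior on `f`
    (Pf : Measure Nonparanormal.Transformation) [IsProbabilityMeasure Pf]
    (hPf : ∀ ε : ℝ, 0 < ε →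
      0 < Pf {f | Nonparanormal.supDist δ f.1 f₀.1 < ENNReal.ofReal ε ∧
        Nonparanormal.supDist δ (deriv f.1) (deriv f₀.1) < ENNReal.ofReal ε})
    -- the prior on `(π⁻, π⁺)`, whose posterior given the counts is consistent
    (Λ : Measure (ℝ × ℝ)) [IsProbabilityMeasure Λ]
    (hΛmem : ∀ᵐ q ∂Λ, 0 < q.1 ∧ 0 < q.2 ∧ q.1 + q.2 < 1)
    (hΛ : ∀ ε : ℝ, 0 < ε → ∀ᵐ ω ∂P, Tendsto
      (fun n : ℕ => Nonparanormal.splitPosterior Λ δ (fun i => X i ω) n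
        {q | |q.1 - Nonparanormal.modelCDF ((μ₀, σ₀), f₀) δ| < ε ∧
          |q.2 - (1 - Nonparanormal.modelCDF ((μ₀, σ₀), f₀) (1 - δ))| < ε})
      atTop (𝓝 1)) :
    ∀ ε : ℝ, 0 < ε → ∀ᵐ ω ∂P, Tendsto
      (fun n : ℕ => Nonparanormal.modifiedPosterior ρ Pf Λ δ (fun i => X i ω) n
        {t | |t.1 - μ₀| < ε ∧ |t.2.1 - σ₀| < ε ∧
          Nonparanormal.supDist δ t.2.2 f₀.1 < ENNReal.ofReal ε})
      atTop (𝓝 1) := by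
  intro ε hε
  set θ₀ : Nonparanormal.Param := ((μ₀, σ₀), f₀) with hθ₀
  have hXQ : ∀ i, P.map (X i) = P.map (X 0) := fun i =>
    Nonparanormal.map_eq_of_transformation (hXmeas i) (hXmem i) (hXmeas 0) (hXmem 0)
      (hXlaw i) (hXlaw 0)
  have hQ : ∀ a b, 0 < a → a ≤ b → b < 1 → P.map (X 0) (Icc a b) = ENNReal.ofReal
      (Nonparanormal.modelCDF θ₀ b - Nonparanormal.modelCDF θ₀ a) := fun a b ha hab hb =>
    Nonparanormal.map_Icc_eq (θ₀ := θ₀) hσ₀ (hXmeas 0) (hXmem 0) (hXlaw 0) ha hab hb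
  obtain ⟨η, hη, hclose⟩ :=
    Nonparanormal.exists_pos_forall_close hδ0 hδ1 (θ₀ := θ₀) hσ₀ hε
  obtain ⟨S, hS, hgrid⟩ := Nonparanormal.exists_finset_monotoneOn_close
    (by linarith : δ < 1 - δ) (Nonparanormal.continuousOn_truncCDF hδ0 θ₀)
    -- The grid doubles `η / 4` to `η / 2`, the tolerance also used for `(π⁻, π⁺)`;
    -- `abs_inducedCDF_sub_lt` doubles it to `η`.
    (by positivity : 0 < η / 4)
  have hA := Nonparanormal.ae_tendsto_truncPosterior hδ0 hδ1 (θ₀ := θ₀) hσ₀ hf₀ hXmeas hXindep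
    hXQ hQ ρ hρpos hρ Pf hPf hS (by positivity : 0 < η / 4)
  filter_upwards [hA, hΛ (η / 2) (half_pos hη)] with ω hA hB
  have hlim := ENNReal.Tendsto.mul hA (.inr ENNReal.one_ne_top) hB (.inr ENNReal.one_ne_top)
  rw [one_mul] at hlim
  -- The event contains a product of two events whose probabilities tend to `1`, so monotonicity
  -- suffices and its own measurability is not needed.
  refine tendsto_of_tendsto_of_tendsto_of_le_of_le hlim tendsto_const_nhds (fun n => ?_) fun n => ?_
  · have : IsFiniteMeasure (Nonparanormal.splitPosterior Λ δ (fun i => X i ω) n) :=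
      ⟨(Nonparanormal.bayesPosterior_univ_le_one _ _).trans_lt ENNReal.one_lt_top⟩
    dsimp only
    rw [← Measure.prod_prod, Nonparanormal.modifiedPosterior]
    refine measure_mono ?_
    rintro ⟨θ, q⟩ ⟨⟨hθ, hθS⟩, hq1, hq2⟩
    refine hclose _ fun x hx => ?_
    have hx' := hgrid _ (Nonparanormal.monotoneOn_truncCDF hδ0 hδ1 hθ) hθS x hx
    have := Nonparanormal.abs_inducedCDF_sub_lt hδ0 hδ1 (θ₀ := θ₀) hσ₀ hθ hq1 hq2 hx
      (by linarith)
    linarith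
  · have : IsFiniteMeasure (Nonparanormal.splitPosterior Λ δ (fun i => X i ω) n) :=
      ⟨(Nonparanormal.bayesPosterior_univ_le_one _ _).trans_lt ENNReal.one_lt_top⟩
    refine (measure_mono (subset_univ _)).trans ?_
    rw [← univ_prod_univ, Measure.prod_prod]
    exact mul_le_one' (Nonparanormal.bayesPosterior_univ_le_one _ _)
      (Nonparanormal.bayesPosterior_univ_le_one _ _)
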